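/- Let $\mathbb T=\mathbb R/\mathbb Z$ with its usual distance and give $\mathbb T^2$ the maximum distance. There is an absolute constant $C>0$ such that the following holds. Let $(\Omega,\mathcal F,\mathbb P,\theta)$ be a probability-preserving transformation, $L\ge 1$, $N=L+1$, $\alpha>0$, $\lambda\in(0,1)$. For each node $i=1,\dots,N$ let $\varphi_i:\mathbb N\times\Omega\times\mathbb T\to\mathbb T$ be measurable with the cocycle property $\varphi_i(0,\omega,\cdot)=\mathrm{id}$, $\varphi_i(t+s,\omega,\cdot)=\varphi_i(t,\theta^s\omega,\cdot)\circ\varphi_i(s,\omega,\cdot)$; assume that the random maps $\varphi_i(1,\theta^t\omega,\cdot)$, $t\in\mathbb N$, $1\le i\le N$, are independent and identically distributed, and that $d(\varphi_i(1,\omega,x),\varphi_i(1,\omega,y))\le\lambda\, d(x,y)$ for all $i,\omega,x,y$. Let $h:\Omega\times\mathbb T^2\to\mathbb R$ be such that $h(\omega,\cdot,\cdot)$ is a random element of $C^4(\mathbb T^2;\mathbb R)$ and the $h(\theta^t\omega,\cdot,\cdot)$, $t\in\mathbb N$, are independent and identically distributed. Let $\Phi_\alpha(t,\omega,x)=x^t=(z^t,x_2^t,\dots,x_N^t)$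 be the star network dynamics with $x^0=x$ and $$z^{t+1}=\varphi_1(1,\theta^t\omega,z^t)+\frac{\alpha}{L}\sum_{j=2}^N h(\theta^t\omega,z^t,x_j^t)\bmod 1,\qquad x_j^{t+1}=\varphi_j(1,\theta^t\omega,x_j^t)+\frac{\alpha}{L}h(\theta^t\omega,x_j^t,z^t)\bmod 1\quad(2\le j\le N).$$ Let $\pi(\omega)=\lim_{n\to\infty}\varphi_1(1,\omega,\cdot)\circ\varphi_1(1,\theta\omega,\cdot)\circ\cdots\circ\varphi_1(1,\theta^{n-1}\omega,p)$, which does not depend on $p\in\mathbb T$, and $m_0=\pi_*\mathbb P$. Then $m_0$ is the unique stationary probability measure of each node chain, i.e. for every $i$ it is the only Borel probability measure $m$ with $\int\mathbb P(\varphi_i(1,\omega,x)\in B)\,dm(x)=m(B)$ for all Borel $B$. Let $\varphi_{\alpha,m_0}$ be the reduced hub system with $\varphi_{\alpha,m_0}(1,\omega,z)=\varphi_1(1,\omega,z)+\alpha\int h(\omega,z,y)\,dm_0(y) \bmod 1$, so that $z^{t+1}=\varphi_{\alpha,m_0}(1,\theta^t\omega,z^t)+\xi(\theta^t\omega,x^t)\bmod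 1$ with the fluctuation $$\xi(\omega,x)=\alpha\Big(\frac1L\sum_{j=2}^N h(\omega,z,x_j)-\int_{\mathbb T} h(\omega,z,y)\,dm_0(y)\Big),\qquad x=(z,x_2,\dots,x_N).$$ The hub is said to admit $\varepsilon$-reduction to $\varphi_{\alpha,m_0}$ on initial data $(\omega,x)$ with exceptional frequency at most $\rho$ if $$\limsup_{T\to\infty}\frac1T\#\{0\le t\le T-1:\ |\xi(\theta^t\omega,\Phi_\alpha(t,\omega,x))|>\varepsilon\}\le\rho .$$ Write $\|g\|_{C^4}=\max_{a+b\le4}\sup|\partial_1^a\partial_2^b g|$. Then for $\mathbb P$-almost every $\omega$ with $\sup_t\|h(\theta^t\omega,\cdot,\cdot)\|_{C^4}<\infty$, for every $$\varepsilon\ge\max\Big\{\alpha L^{-1/2},\ 4\alpha^2L^{-1}(1-\lambda)^{-1}\sup_{t}\|h(\theta^t\omega,\cdot,\cdot)\|_{C^0}\,\sup_{t}|h(\theta^t\omega,\cdot,\cdot)|_{\mathrm{Lip}}\Big\}$$ and every $x\in\mathbb T^N$, the hub admits $\varepsilon$-reduction to $\varphi_{\alpha,m_0}$ on $(\omega,x)$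 with exceptional frequency at most $$\rho(\varepsilon,\omega)=D(\varepsilon,\omega)\exp\big(-L\varepsilon^2\alpha^{-2}c(\omega)\big),\qquad D(\varepsilon,\omega)=C\,\varepsilon^{-1}\sup_t\|h(\theta^t\omega,\cdot,\cdot)\|_{C^4},\quad c(\omega)=\frac{450}{\sup_t\|h(\theta^t\omega,\cdot,\cdot)\|_{C^4}^2}.$$ (If the last supremum is $0$, the exceptional frequency is $0$.) -/

import Mathlib

open MeasureTheory ProbabilityTheory Filter

/-- A measurable random dynamical system `φ : ℕ × Ω × M → M` over `θ : Ω → Ω`: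
measurable in `(ω, x)` at every time, with the cocycle property. -/
structure IsRDS {Ω M : Type*} [MeasurableSpace Ω] [MeasurableSpace M]
    (θ : Ω → Ω) (φ : ℕ → Ω → M → M) : Prop where
  measurable : ∀ t, Measurable (fun p : Ω × M => φ t p.1 p.2)
  zero : ∀ ω x, φ 0 ω x = x
  add : ∀ t s ω x, φ (t + s) ω x = φ t (θ^[s] ω) (φ s ω x)

/-- The node maps `φ i 1 (θ^t ω)` are independent and identically distributed over all times `t` and
nodes `i`. Maps of the circle carry the σ-algebra generated by the evaluations; on the continuous
maps this is the Borel σ-algebra of uniform convergence. -/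
structure IIDNodeMaps {Ω ι : Type*} [MeasurableSpace Ω] (P : Measure Ω) (θ : Ω → Ω)
    (φ : ι → ℕ → Ω → UnitAddCircle → UnitAddCircle) : Prop where
  indep : iIndepFun (fun (p : ℕ × ι) (ω : Ω) (x : UnitAddCircle) => φ p.2 1 (θ^[p.1] ω) x) P
  ident : ∀ p q : ℕ × ι,
    IdentDistrib (fun (ω : Ω) (x : UnitAddCircle) => φ p.2 1 (θ^[p.1] ω) x)
      (fun (ω : Ω) (x : UnitAddCircle) => φ q.2 1 (θ^[q.1] ω) x) P P

/-- `g : 𝕋 × 𝕋 → ℝ` is of class `C⁴`: its doubly 1-periodic lift to `ℝ × ℝ` is. -/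
def IsC4 (g : UnitAddCircle → UnitAddCircle → ℝ) : Prop :=
  ContDiff ℝ 4 (fun p : ℝ × ℝ => g (p.1 : UnitAddCircle) (p.2 : UnitAddCircle))

/-- The coupling functions `h (θ^t ω)` are random elements of `C⁴(𝕋², ℝ)` which are independent and
identically distributed in time `t`. Functions on `𝕋²` carry the σ-algebra generated by the
evaluations; on `C⁴(𝕋², ℝ)` this is the Borel σ-algebra. -/
structure IIDCoupling {Ω : Type*} [MeasurableSpace Ω] (P : Measure Ω) (θ : Ω → Ω)
    (h : Ω → UnitAddCircle → UnitAddCircle → ℝ) : Prop where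
  measurable : ∀ x y, Measurable (fun ω => h ω x y)
  smooth : ∀ ω, IsC4 (h ω)
  indep : iIndepFun (fun (t : ℕ) (ω : Ω) (x y : UnitAddCircle) => h (θ^[t] ω) x y) P
  ident : ∀ t s : ℕ,
    IdentDistrib (fun (ω : Ω) (x y : UnitAddCircle) => h (θ^[t] ω) x y)
      (fun (ω : Ω) (x y : UnitAddCircle) => h (θ^[s] ω) x y) P P

/-- `m` is a stationary probability measure of the Markov chain with transition probability
`P(x, B) = ℙ(φ(1, ω, x) ∈ B)`. -/
structure IsStationaryMeasure {Ω M : Type*} [MeasurableSpace Ω] [MeasurableSpace M] (P : Measure Ω)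
    (φ : ℕ → Ω → M → M) (m : Measure M) : Prop where
  isProb : IsProbabilityMeasure m
  stationary : ∀ B : Set M, MeasurableSet B → ∫⁻ x, P {ω | φ 1 ω x ∈ B} ∂m = m B

/-- `φ(1, ω, ·) ∘ φ(1, θ ω, ·) ∘ ⋯ ∘ φ(1, θ^(n-1) ω, ·)` applied to `p`. -/
def backwardIterate {Ω M : Type*} (θ : Ω → Ω) (φ : ℕ → Ω → M → M) (p : M) : ℕ → Ω → M
  | 0, _ => p
  | n + 1, ω => φ 1 ω (backwardIterate θ φ p n (θ ω))

/-- The coding map `π(ω) = lim_n φ(1, ω, ·) ∘ ⋯ ∘ φ(1, θ^(n-1) ω, p)`. For uniform contractions the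
limit exists and does not depend on the base point `p`; the base point used here is `0`. -/
noncomputable def codingMap {Ω : Type*} (θ : Ω → Ω) (φ : ℕ → Ω → UnitAddCircle → UnitAddCircle)
    (ω : Ω) : UnitAddCircle :=
  limUnder atTop (fun n : ℕ => backwardIterate θ φ 0 n ω)

/-- The push-forward `π_* ℙ` of the noise under the coding map. -/
noncomputable def codingMeasure {Ω : Type*} [MeasurableSpace Ω] (P : Measure Ω) (θ : Ω → Ω)
    (φ : ℕ → Ω → UnitAddCircle → UnitAddCircle) : Measure UnitAddCircle :=
  P.map (codingMap θ φ)

/-- `‖g‖_{C⁰} = sup |g|`. -/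
noncomputable def normC0 (g : UnitAddCircle → UnitAddCircle → ℝ) : ℝ :=
  ⨆ p : UnitAddCircle × UnitAddCircle, |g p.1 p.2|

/-- `|g|_Lip`, the smallest Lipschitz constant of `g` on `𝕋²` with the maximum distance. -/
noncomputable def lipConst (g : UnitAddCircle → UnitAddCircle → ℝ) : ℝ :=
  sInf {K : ℝ | 0 ≤ K ∧
    ∀ p q : UnitAddCircle × UnitAddCircle, |g p.1 p.2 - g q.1 q.2| ≤ K * dist p q}

/-- The partial derivative `∂₁^a ∂₂^b g`, as a doubly periodic function on `ℝ²`. -/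
noncomputable def mixedDeriv (g : UnitAddCircle → UnitAddCircle → ℝ) (a b : ℕ) (x y : ℝ) : ℝ :=
  iteratedDeriv a
    (fun s : ℝ => iteratedDeriv b (fun r : ℝ => g (s : UnitAddCircle) (r : UnitAddCircle)) y) x

/-- `‖g‖_{C⁴}`, the maximum over `a + b ≤ 4` of `sup |∂₁^a ∂₂^b g|`. -/
noncomputable def normC4 (g : UnitAddCircle → UnitAddCircle → ℝ) : ℝ :=
  sSup {r : ℝ | ∃ (a b : ℕ) (x y : ℝ), a + b ≤ 4 ∧ r = |mixedDeriv g a b x y|}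

section Star

variable {Ω : Type*} {L : ℕ}

/-- One step of the star network with hub `0` and low-degree nodes `1, …, L`. -/
noncomputable def starStep (φ : Fin (L + 1) → ℕ → Ω → UnitAddCircle → UnitAddCircle)
    (h : Ω → UnitAddCircle → UnitAddCircle → ℝ) (α : ℝ) (ω : Ω)
    (x : Fin (L + 1) → UnitAddCircle) : Fin (L + 1) → UnitAddCircle :=
  Fin.cons
    (φ 0 1 ω (x 0) + ((α * (1 / (L : ℝ) * ∑ j : Fin L, h ω (x 0) (x j.succ)) : ℝ) : UnitAddCircle))
    (fun j : Fin L =>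
      φ j.succ 1 ω (x j.succ) + ((α * (1 / (L : ℝ) * h ω (x j.succ) (x 0)) : ℝ) : UnitAddCircle))

/-- The star network trajectory `x^t = Φ_α(t, ω, x)`. -/
noncomputable def starOrbit (θ : Ω → Ω) (φ : Fin (L + 1) → ℕ → Ω → UnitAddCircle → UnitAddCircle)
    (h : Ω → UnitAddCircle → UnitAddCircle → ℝ) (α : ℝ) :
    ℕ → Ω → (Fin (L + 1) → UnitAddCircle) → Fin (L + 1) → UnitAddCircle
  | 0, _, x => x
  | t + 1, ω, x => starStep φ h α (θ^[t] ω) (starOrbit θ φ h α t ω x)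

/-- The mean-field reduced hub system `φ_{α,m}`, built from the hub map `φ₁`. -/
noncomputable def reducedHub (θ : Ω → Ω) (φ₁ : ℕ → Ω → UnitAddCircle → UnitAddCircle)
    (h : Ω → UnitAddCircle → UnitAddCircle → ℝ) (α : ℝ) (m : Measure UnitAddCircle) :
    ℕ → Ω → UnitAddCircle → UnitAddCircle
  | 0, _, z => z
  | t + 1, ω, z =>
    φ₁ 1 (θ^[t] ω) (reducedHub θ φ₁ h α m t ω z) +
      ((α * ∫ y, h (θ^[t] ω) (reducedHub θ φ₁ h α m t ω z) y ∂m : ℝ) : UnitAddCircle)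

/-- The fluctuation `ξ_m(ω, x)` of the coupling term of the hub around its mean-field value. -/
noncomputable def fluctuation (h : Ω → UnitAddCircle → UnitAddCircle → ℝ) (α : ℝ)
    (m : Measure UnitAddCircle) (ω : Ω) (x : Fin (L + 1) → UnitAddCircle) : ℝ :=
  α * (1 / (L : ℝ) * ∑ j : Fin L, h ω (x 0) (x j.succ) - ∫ y, h ω (x 0) y ∂m)

/-- `z^{t+1} = φ_{α,m}(1, θ^t ω, z^t) + ξ_m(θ^t ω, x^t) mod 1`. -/
theorem hub_eq_reducedHub_add_fluctuation (θ : Ω → Ω)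
    (φ : Fin (L + 1) → ℕ → Ω → UnitAddCircle → UnitAddCircle)
    (h : Ω → UnitAddCircle → UnitAddCircle → ℝ) (α : ℝ) (m : Measure UnitAddCircle)
    (t : ℕ) (ω : Ω) (x : Fin (L + 1) → UnitAddCircle) :
    starOrbit θ φ h α (t + 1) ω x 0 =
      reducedHub θ (φ 0) h α m 1 (θ^[t] ω) (starOrbit θ φ h α t ω x 0) +
        ((fluctuation h α m (θ^[t] ω) (starOrbit θ φ h α t ω x) : ℝ) : UnitAddCircle) := by
  simp only [starOrbit, starStep, reducedHub, fluctuation, Fin.cons_zero, Function.iterate_zero,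
    id_eq, add_assoc, ← AddCircle.coe_add]
  congr 2
  ring

/-- The hub admits `ε`-reduction to `φ_{α,m}` on initial data `(ω, x)` at time `t`. -/
def AdmitsReductionAt (θ : Ω → Ω) (φ : Fin (L + 1) → ℕ → Ω → UnitAddCircle → UnitAddCircle)
    (h : Ω → UnitAddCircle → UnitAddCircle → ℝ) (α : ℝ) (m : Measure UnitAddCircle) (ε : ℝ)
    (ω : Ω) (x : Fin (L + 1) → UnitAddCircle) (t : ℕ) : Prop :=
  |fluctuation h α m (θ^[t] ω) (starOrbit θ φ h α t ω x)| ≤ ε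

open scoped Classical in
/-- The hub admits `ε`-reduction to `φ_{α,m}` on initial data `(ω, x)` with exceptional frequency at
most `ρ`: the upper asymptotic frequency of the times without `ε`-reduction is at most `ρ`. -/
def AdmitsReduction (θ : Ω → Ω) (φ : Fin (L + 1) → ℕ → Ω → UnitAddCircle → UnitAddCircle)
    (h : Ω → UnitAddCircle → UnitAddCircle → ℝ) (α : ℝ) (m : Measure UnitAddCircle) (ε ρ : ℝ)
    (ω : Ω) (x : Fin (L + 1) → UnitAddCircle) : Prop :=
  limsup (fun T : ℕ =>
    (((Finset.range T).filter (fun t => ¬ AdmitsReductionAt θ φ h α m ε ω x t)).card : ℝ) / (T : ℝ))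
    atTop ≤ ρ

end Star

/-!
After `n` steps, a low-degree node of the network is within `α A / (L (1 - λ)) + λ ^ n / 2` of the
uncoupled node orbit started at a fixed point and driven by the same noise, where
`A = sup_t ‖h (θ^t ω)‖_{C⁰}`: each step adds at most `α A / L` and contracts by `λ`. The uncoupled
orbits are independent with laws close to `m₀`, so Hoeffding's inequality controls each Fourier
coefficient of their empirical measure. A union bound over all frequencies `k`, with threshold
growing like `k ^ (1 / 4)`, controls every Lipschitz observable simultaneously: by Cauchy-Schwarz
the error is bounded through `Σ |k f̂(k)|² < ∞` and `Σ k ^ (-3 / 2) < ∞`, so the hub coordinate and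
the noise may vary freely and no `ε`-net is needed. The resulting event depends only on `n`
consecutive steps of the noise, and the strong law of large numbers turns its probability into a
frequency.

The factor `ε⁻¹` comes from Landau's inequality `Lip² ≤ 8 ‖·‖_{C⁰} ‖·‖_{C⁴}` and the lower bound on
`ε`; the constant `450` comes from `Lip ≤ ‖·‖_{C⁴} / 32`, since for periodic functions each
derivative gains a factor `1 / 4`.
-/

/-! ### Derivatives of functions with Lipschitz derivative -/

section OneVariable

open scoped NNReal

variable {E : Type*} [NormedAddCommGroup E] [NormedSpace ℝ E] {f f' : ℝ → E} {K : ℝ≥0}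

theorem norm_symmetric_sub_sub_smul_le (hf : ∀ x, HasDerivAt f (f' x) x)
    (hf' : LipschitzWith K f') (x : ℝ) {s : ℝ} (hs : 0 ≤ s) :
    ‖f (x + s) - f (x - s) - (2 * s) • f' x‖ ≤ K * s ^ 2 := by
  have hderiv (r : ℝ) : HasDerivAt (fun r => f (x + r) - f (x - r) - (2 * r) • f' x)
      ((f' (x + r) - f' x) + (f' (x - r) - f' x)) r := by
    refine ((((hf (x + r)).comp_const_add x r).sub ((hf (x - r)).comp_const_sub x r)).sub
      (((hasDerivAt_id r).const_mul 2).smul_const (f' x))).congr_deriv ?_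
    module
  have hbound (r : ℝ) (hr : 0 ≤ r) :
      ‖(f' (x + r) - f' x) + (f' (x - r) - f' x)‖ ≤ K * (2 * r) := by
    have hright := hf'.dist_le_mul (x + r) x
    have hleft := hf'.dist_le_mul (x - r) x
    simp only [dist_eq_norm, add_sub_cancel_left, sub_sub_cancel_left, norm_neg,
      Real.norm_of_nonneg hr] at hright hleft
    linarith [norm_add_le (f' (x + r) - f' x) (f' (x - r) - f' x)]
  refine image_norm_le_of_norm_deriv_right_le_deriv_boundary (a := 0) (b := s)
    (fun r _ => (hderiv r).continuousAt.continuousWithinAt)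
    (fun r _ => (hderiv r).hasDerivWithinAt) (B := fun r => K * r ^ 2) (by simp)
    (fun r => (by simpa using (hasDerivAt_pow 2 r).const_mul (K : ℝ)))
    (fun r hr => hbound r hr.1) (Set.right_mem_Icc.2 hs)

/-- The Landau–Kolmogorov inequality on the line, with its sharp constant. -/
theorem norm_deriv_sq_le_of_lipschitzWith (hf : ∀ x, HasDerivAt f (f' x) x)
    (hf' : LipschitzWith K f') {A : ℝ} (hA : ∀ x, ‖f x‖ ≤ A) (x : ℝ) :
    ‖f' x‖ ^ 2 ≤ 2 * A * K := by
  have hquadratic (s : ℝ) : 0 ≤ K * (s * s) + (-(2 * ‖f' x‖)) * s + 2 * A := by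
    have hsym := norm_symmetric_sub_sub_smul_le hf hf' x (abs_nonneg s)
    have hsmul : ‖(2 * |s|) • f' x‖ = 2 * |s| * ‖f' x‖ := by
      rw [norm_smul, Real.norm_of_nonneg (by positivity)]
    have htri := norm_sub_norm_le ((2 * |s|) • f' x) (f (x + |s|) - f (x - |s|))
    rw [norm_sub_rev ((2 * |s|) • f' x), hsmul] at htri
    rw [sq_abs, pow_two] at hsym
    have hs := mul_le_mul_of_nonneg_right (le_abs_self s) (norm_nonneg (f' x))
    linarith [norm_sub_le (f (x + |s|)) (f (x - |s|)), hA (x + |s|), hA (x - |s|)]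
  have hdiscrim := discrim_le_zero hquadratic
  rw [discrim] at hdiscrim
  linarith

theorem norm_deriv_sq_le_of_iteratedDeriv_two (hf : ContDiff ℝ 2 f) {A : ℝ} (hA : ∀ x, ‖f x‖ ≤ A)
    (hK : ∀ x, ‖iteratedDeriv 2 f x‖ ≤ K) (x : ℝ) : ‖deriv f x‖ ^ 2 ≤ 2 * A * K := by
  refine norm_deriv_sq_le_of_lipschitzWith
    (fun y => (hf.differentiable (by simp) y).hasDerivAt) ?_ hA x
  refine lipschitzWith_of_nnnorm_deriv_le
    ((contDiff_succ_iff_deriv (n := 1)).1 hf |>.2.2.differentiable (by simp)) fun y => ?_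
  simpa only [iteratedDeriv_succ, iteratedDeriv_zero, ← NNReal.coe_le_coe, coe_nnnorm] using hK y

theorem norm_deriv_le_of_periodic (hf : ∀ x, HasDerivAt f (f' x) x) (hf' : LipschitzWith K f')
    {T : ℝ} (hT : 0 < T) (hper : Function.Periodic f T) (x : ℝ) : ‖f' x‖ ≤ K * T / 4 := by
  have hsym := norm_symmetric_sub_sub_smul_le hf hf' x (half_pos hT).le
  have heq : f (x + T / 2) = f (x - T / 2) := by
    rw [← hper (x - T / 2), sub_add_eq_add_sub, add_sub_assoc, sub_half]
  rw [heq, sub_self, zero_sub, norm_neg, norm_smul, mul_div_cancel₀ _ two_ne_zero,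
    Real.norm_of_nonneg hT.le] at hsym
  refine le_of_mul_le_mul_left (hsym.trans_eq ?_) hT
  ring

theorem periodic_deriv {T : ℝ} (hf : Function.Periodic f T) : Function.Periodic (deriv f) T :=
  fun x => by rw [← deriv_comp_add_const, hf.funext]

theorem periodic_iteratedDeriv {T : ℝ} (hf : Function.Periodic f T) (k : ℕ) :
    Function.Periodic (iteratedDeriv k f) T := fun x => by
  rw [← congrFun (iteratedDeriv_comp_add_const k f T) x, hf.funext]

theorem norm_deriv_le_of_periodic_of_iteratedDeriv {T : ℝ} (hT : 0 < T) {n : ℕ} {H : ℝ≥0}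
    (hf : ContDiff ℝ (n + 1 : ℕ) f) (hper : Function.Periodic f T)
    (hH : ∀ x, ‖iteratedDeriv (n + 1) f x‖ ≤ H) (x : ℝ) :
    ‖deriv f x‖ ≤ H * (T / 4) ^ n := by
  induction n generalizing f x with
  | zero => simpa [iteratedDeriv_one] using hH x
  | succ n ih =>
    have hdiff : ContDiff ℝ (n + 1 : ℕ) (deriv f) := hf.deriv'
    have hlip : LipschitzWith (H * (T / 4).toNNReal ^ n) (deriv f) := by
      refine lipschitzWith_of_nnnorm_deriv_le (hdiff.differentiable (by simp)) fun y => ?_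
      have := ih hdiff (periodic_deriv hper) (by simpa only [iteratedDeriv_succ'] using hH) y
      rw [← NNReal.coe_le_coe]
      rwa [NNReal.coe_mul, NNReal.coe_pow, Real.coe_toNNReal _ (by positivity)]
    refine (norm_deriv_le_of_periodic (fun y => (hf.differentiable (by simp) y).hasDerivAt)
      hlip hT hper x).trans_eq ?_
    rw [NNReal.coe_mul, NNReal.coe_pow, Real.coe_toNNReal _ (by positivity)]
    ring

end OneVariable

/-! ### Lipschitz functions on the circle -/

section Circle

open scoped NNReal

variable {T : ℝ}

theorem exists_coe_eq_and_abs_sub_eq_dist (p q : AddCircle T) :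
    ∃ x y : ℝ, (x : AddCircle T) = p ∧ (y : AddCircle T) = q ∧ |x - y| = dist p q := by
  obtain ⟨y, rfl⟩ := QuotientAddGroup.mk_surjective q
  obtain ⟨u, hu⟩ := QuotientAddGroup.mk_surjective (p - (y : AddCircle T))
  change (u : AddCircle T) = p - (y : AddCircle T) at hu
  refine ⟨y + (u - round (T⁻¹ * u) * T), y, ?_, rfl, ?_⟩
  · have hround : ((round (T⁻¹ * u) * T : ℝ) : AddCircle T) = 0 :=
      (AddCircle.coe_eq_zero_iff T).2 ⟨round (T⁻¹ * u), by simp⟩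
    rw [AddCircle.coe_add, AddCircle.coe_sub, hround, sub_zero, hu, add_sub_cancel]
  · rw [add_sub_cancel_left, dist_eq_norm, ← hu, AddCircle.norm_eq]

theorem lipschitzWith_coe_addCircle : LipschitzWith 1 fun x : ℝ => (x : AddCircle T) :=
  LipschitzWith.of_dist_le_mul fun x y => by
    simp only [NNReal.coe_one, one_mul, dist_eq_norm, ← AddCircle.coe_sub]
    exact QuotientAddGroup.norm_mk_le_norm

theorem lipschitzWith_of_comp_coe {X : Type*} [PseudoMetricSpace X] {K : ℝ≥0}
    {g : AddCircle T → X} (hg : LipschitzWith K fun x : ℝ => g x) : LipschitzWith K g :=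
  LipschitzWith.of_dist_le_mul fun p q => by
    obtain ⟨x, y, rfl, rfl, hxy⟩ := exists_coe_eq_and_abs_sub_eq_dist p q
    rw [← hxy, ← Real.dist_eq]
    exact hg.dist_le_mul x y

theorem dist_unitAddCircle_le_half (p q : UnitAddCircle) : dist p q ≤ 1 / 2 := by
  simpa [dist_eq_norm] using AddCircle.norm_le_half_period (1 : ℝ) (x := p - q) one_ne_zero

end Circle

/-! ### Partial derivatives of functions on the torus -/

section PartialDerivatives

theorem exists_forall_norm_le_of_periodic {E : Type*} [SeminormedAddCommGroup E] {F : ℝ × ℝ → E}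
    (hF : Continuous F) (hfst : ∀ y, Function.Periodic (fun x => F (x, y)) 1)
    (hsnd : ∀ x, Function.Periodic (fun y => F (x, y)) 1) : ∃ M, ∀ p, ‖F p‖ ≤ M := by
  obtain ⟨M, hM⟩ := ((isCompact_Icc.prod isCompact_Icc).exists_bound_of_continuousOn
    (s := Set.Icc (0 : ℝ) 1 ×ˢ Set.Icc (0 : ℝ) 1) hF.continuousOn)
  refine ⟨M, fun ⟨x, y⟩ => ?_⟩
  have hx : F (Int.fract x, y) = F (x, y) := by
    simpa using (hfst y).sub_int_mul_eq (x := x) ⌊x⌋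
  have hy : F (Int.fract x, Int.fract y) = F (Int.fract x, y) := by
    simpa using (hsnd (Int.fract x)).sub_int_mul_eq (x := y) ⌊y⌋
  rw [← hx, ← hy]
  exact hM _ ⟨⟨Int.fract_nonneg x, (Int.fract_lt_one x).le⟩,
    ⟨Int.fract_nonneg y, (Int.fract_lt_one y).le⟩⟩

variable {E : Type*} [NormedAddCommGroup E] [NormedSpace ℝ E]

theorem contDiff_iteratedDeriv_snd {F : ℝ × ℝ → E} {m : ℕ} (b : ℕ)
    (hF : ContDiff ℝ (m + b : ℕ) F) :
    ContDiff ℝ m fun p : ℝ × ℝ => iteratedDeriv b (fun r => F (p.1, r)) p.2 := by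
  induction b generalizing m with
  | zero => simpa using hF
  | succ b ih =>
    have hprev : ContDiff ℝ (m + 1 : ℕ)
        fun p : ℝ × ℝ => iteratedDeriv b (fun r => F (p.1, r)) p.2 :=
      ih (by rwa [add_right_comm])
    have hsucc (p : ℝ × ℝ) : iteratedDeriv (b + 1) (fun r => F (p.1, r)) p.2 =
        fderiv ℝ (fun p : ℝ × ℝ => iteratedDeriv b (fun r => F (p.1, r)) p.2) p (0, 1) := by
      rw [iteratedDeriv_succ]
      exact (((hprev.differentiable (by simp) p).hasFDerivAt).comp_hasDerivAt p.2
        ((hasDerivAt_const p.2 p.1).prodMk (hasDerivAt_id p.2))).deriv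
    simp only [hsucc]
    exact (hprev.fderiv_right (m := m) (by norm_cast)).clm_apply contDiff_const

theorem contDiff_iteratedDeriv_fst {F : ℝ × ℝ → E} {m : ℕ} (a : ℕ)
    (hF : ContDiff ℝ (m + a : ℕ) F) :
    ContDiff ℝ m fun p : ℝ × ℝ => iteratedDeriv a (fun s => F (s, p.2)) p.1 :=
  (contDiff_iteratedDeriv_snd a (hF.comp (contDiff_snd.prodMk contDiff_fst))).comp
    (contDiff_snd.prodMk contDiff_fst)

end PartialDerivatives

/-! ### Norms of `C⁴` functions on the torus -/

section C4

open scoped NNReal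

variable {g : UnitAddCircle → UnitAddCircle → ℝ}

theorem periodic_mixedDeriv_left (g : UnitAddCircle → UnitAddCircle → ℝ) (a b : ℕ) (y : ℝ) :
    Function.Periodic (fun x => mixedDeriv g a b x y) 1 :=
  periodic_iteratedDeriv (fun s => by simp) a

theorem periodic_mixedDeriv_right (g : UnitAddCircle → UnitAddCircle → ℝ) (a b : ℕ) (x : ℝ) :
    Function.Periodic (fun y => mixedDeriv g a b x y) 1 := fun y =>
  congrArg (fun F => iteratedDeriv a F x)
    (funext fun _ => periodic_iteratedDeriv (fun r => by simp) b y)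

namespace IsC4

theorem continuous_mixedDeriv (hg : IsC4 g) {a b : ℕ} (hab : a + b ≤ 4) :
    Continuous fun p : ℝ × ℝ => mixedDeriv g a b p.1 p.2 := by
  obtain ⟨c, hc⟩ := Nat.exists_eq_add_of_le hab
  have hsmooth : ContDiff ℝ (c + a + b : ℕ)
      fun p : ℝ × ℝ => g (p.1 : UnitAddCircle) (p.2 : UnitAddCircle) := by
    rwa [show c + a + b = 4 by omega]
  exact (contDiff_iteratedDeriv_fst (m := c) a (contDiff_iteratedDeriv_snd b hsmooth)).continuous

theorem abs_mixedDeriv_le_normC4 (hg : IsC4 g) {a b : ℕ} (hab : a + b ≤ 4) (x y : ℝ) :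
    |mixedDeriv g a b x y| ≤ normC4 g := by
  refine le_csSup ?_ ⟨a, b, x, y, hab, rfl⟩
  have hfinite : {q : ℕ × ℕ | q.1 + q.2 ≤ 4}.Finite :=
    (Set.finite_Iic ((4, 4) : ℕ × ℕ)).subset fun q (hq : q.1 + q.2 ≤ 4) =>
      Prod.le_def.2 ⟨by lia, by lia⟩
  have hbdd : BddAbove (⋃ q ∈ {q : ℕ × ℕ | q.1 + q.2 ≤ 4},
      Set.range fun p : ℝ × ℝ => |mixedDeriv g q.1 q.2 p.1 p.2|) := by
    refine (hfinite.bddAbove_biUnion).2 fun q hq => ?_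
    obtain ⟨M, hM⟩ := exists_forall_norm_le_of_periodic (hg.continuous_mixedDeriv hq)
      (periodic_mixedDeriv_left g q.1 q.2) (periodic_mixedDeriv_right g q.1 q.2)
    exact ⟨M, Set.forall_mem_range.2 hM⟩
  refine hbdd.mono ?_
  rintro _ ⟨a, b, x, y, hab, rfl⟩
  exact Set.mem_biUnion (x := (a, b)) hab ⟨(x, y), rfl⟩

theorem normC4_nonneg (hg : IsC4 g) : 0 ≤ normC4 g :=
  (abs_nonneg _).trans (hg.abs_mixedDeriv_le_normC4 (a := 0) (b := 0) (by norm_num) 0 0)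

theorem abs_le_normC4 (hg : IsC4 g) (p q : UnitAddCircle) : |g p q| ≤ normC4 g := by
  obtain ⟨x, rfl⟩ := QuotientAddGroup.mk_surjective p
  obtain ⟨y, rfl⟩ := QuotientAddGroup.mk_surjective q
  simpa [mixedDeriv] using hg.abs_mixedDeriv_le_normC4 (a := 0) (b := 0) (by norm_num) x y

theorem abs_le_normC0 (hg : IsC4 g) (p q : UnitAddCircle) : |g p q| ≤ normC0 g :=
  le_ciSup (f := fun p : UnitAddCircle × UnitAddCircle => |g p.1 p.2|)
    ⟨normC4 g, Set.forall_mem_range.2 fun p => hg.abs_le_normC4 p.1 p.2⟩ (p, q)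

theorem normC0_le_normC4 (hg : IsC4 g) : normC0 g ≤ normC4 g :=
  ciSup_le fun p => hg.abs_le_normC4 p.1 p.2

theorem contDiff_left (hg : IsC4 g) (y : UnitAddCircle) : ContDiff ℝ 4 fun x : ℝ => g x y := by
  obtain ⟨y, rfl⟩ := QuotientAddGroup.mk_surjective y
  exact ContDiff.comp hg (contDiff_id.prodMk contDiff_const)

theorem contDiff_right (hg : IsC4 g) (x : UnitAddCircle) : ContDiff ℝ 4 fun y : ℝ => g x y := by
  obtain ⟨x, rfl⟩ := QuotientAddGroup.mk_surjective x
  exact ContDiff.comp (g := fun p : ℝ × ℝ => g (p.1 : UnitAddCircle) (p.2 : UnitAddCircle)) hg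
    (contDiff_const.prodMk contDiff_id)

theorem abs_iteratedDeriv_left_le (hg : IsC4 g) {k : ℕ} (hk : k ≤ 4) (y : UnitAddCircle) (x : ℝ) :
    |iteratedDeriv k (fun x : ℝ => g x y) x| ≤ normC4 g := by
  obtain ⟨y, rfl⟩ := QuotientAddGroup.mk_surjective y
  simpa [mixedDeriv] using hg.abs_mixedDeriv_le_normC4 (a := k) (b := 0) hk x y

theorem abs_iteratedDeriv_right_le (hg : IsC4 g) {k : ℕ} (hk : k ≤ 4) (x : UnitAddCircle)
    (y : ℝ) : |iteratedDeriv k (fun y : ℝ => g x y) y| ≤ normC4 g := by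
  obtain ⟨x, rfl⟩ := QuotientAddGroup.mk_surjective x
  simpa [mixedDeriv] using hg.abs_mixedDeriv_le_normC4 (a := 0) (b := k) (by simpa using hk) x y

theorem lipschitzWith_uncurry_of_abs_deriv_le (hg : IsC4 g) {K : ℝ≥0}
    (hleft : ∀ y : UnitAddCircle, ∀ x : ℝ, |deriv (fun x : ℝ => g x y) x| ≤ K)
    (hright : ∀ x : UnitAddCircle, ∀ y : ℝ, |deriv (fun y : ℝ => g x y) y| ≤ K) :
    LipschitzWith (2 * K) (Function.uncurry g) := by
  rw [two_mul]
  refine LipschitzWith.uncurry (fun y => lipschitzWith_of_comp_coe ?_)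
    fun x => lipschitzWith_of_comp_coe ?_
  · exact lipschitzWith_of_nnnorm_deriv_le ((hg.contDiff_left y).differentiable (by simp)) (hleft y)
  · exact lipschitzWith_of_nnnorm_deriv_le ((hg.contDiff_right x).differentiable (by simp))
      (hright x)

theorem lipschitzWith_uncurry_normC4 (hg : IsC4 g) :
    LipschitzWith (2 * (normC4 g / 64).toNNReal) (Function.uncurry g) := by
  have hH := Real.coe_toNNReal _ hg.normC4_nonneg
  have hK : ((normC4 g / 64).toNNReal : ℝ) = (normC4 g).toNNReal * (1 / 4) ^ 3 := by
    rw [Real.coe_toNNReal _ (div_nonneg hg.normC4_nonneg (by norm_num)), hH]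
    ring
  refine hg.lipschitzWith_uncurry_of_abs_deriv_le (fun y x => ?_) fun x y => ?_
  · rw [hK, ← Real.norm_eq_abs]
    refine norm_deriv_le_of_periodic_of_iteratedDeriv one_pos (hg.contDiff_left y)
      (fun x => by simp) (fun x => ?_) x
    exact hH.symm ▸ hg.abs_iteratedDeriv_left_le le_rfl y x
  · rw [hK, ← Real.norm_eq_abs]
    refine norm_deriv_le_of_periodic_of_iteratedDeriv one_pos (hg.contDiff_right x)
      (fun y => by simp) (fun y => ?_) y
    exact hH.symm ▸ hg.abs_iteratedDeriv_right_le le_rfl x y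

theorem lipschitzWith_uncurry_sqrt (hg : IsC4 g) :
    LipschitzWith (2 * (√(2 * normC0 g * normC4 g)).toNNReal) (Function.uncurry g) := by
  have hH := Real.coe_toNNReal _ hg.normC4_nonneg
  refine hg.lipschitzWith_uncurry_of_abs_deriv_le (fun y x => ?_) fun x y => ?_
  · rw [Real.coe_toNNReal _ (Real.sqrt_nonneg _), ← hH]
    refine Real.abs_le_sqrt ((sq_abs _).symm.trans_le (norm_deriv_sq_le_of_iteratedDeriv_two
      ((hg.contDiff_left y).of_le (by norm_num)) (fun x => hg.abs_le_normC0 x y) (fun x => ?_) x))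
    exact hH.symm ▸ hg.abs_iteratedDeriv_left_le (by norm_num) y x
  · rw [Real.coe_toNNReal _ (Real.sqrt_nonneg _), ← hH]
    refine Real.abs_le_sqrt ((sq_abs _).symm.trans_le (norm_deriv_sq_le_of_iteratedDeriv_two
      ((hg.contDiff_right x).of_le (by norm_num)) (fun y => hg.abs_le_normC0 x y) (fun y => ?_) y))
    exact hH.symm ▸ hg.abs_iteratedDeriv_right_le (by norm_num) x y

end IsC4

theorem lipConst_nonneg (g : UnitAddCircle → UnitAddCircle → ℝ) : 0 ≤ lipConst g :=
  Real.sInf_nonneg fun _ h => h.1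

theorem lipConst_le_of_lipschitzWith {K : ℝ≥0} (hg : LipschitzWith K (Function.uncurry g)) :
    lipConst g ≤ K :=
  csInf_le ⟨0, fun _ h => h.1⟩ ⟨K.2, fun p q => hg.dist_le_mul p q⟩

theorem dist_le_lipConst_mul_of_lipschitzWith {K : ℝ≥0}
    (hg : LipschitzWith K (Function.uncurry g)) (p q : UnitAddCircle × UnitAddCircle) :
    dist (g p.1 p.2) (g q.1 q.2) ≤ lipConst g * dist p q := by
  rcases (dist_nonneg (x := p) (y := q)).eq_or_lt with h | h
  · simpa [← h, Function.uncurry] using hg.dist_le_mul p q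
  · rw [← div_le_iff₀ h]
    exact le_csInf ⟨K, K.2, fun p q => hg.dist_le_mul p q⟩ fun M hM =>
      (div_le_iff₀ h).2 (hM.2 p q)

namespace IsC4

theorem lipConst_le_normC4 (hg : IsC4 g) : lipConst g ≤ normC4 g / 32 := by
  refine (lipConst_le_of_lipschitzWith hg.lipschitzWith_uncurry_normC4).trans_eq ?_
  rw [NNReal.coe_mul, Real.coe_toNNReal _ (div_nonneg hg.normC4_nonneg (by norm_num))]
  simp only [NNReal.coe_ofNat]
  ring

theorem lipConst_le_sqrt (hg : IsC4 g) : lipConst g ≤ 2 * √(2 * normC0 g * normC4 g) := by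
  refine (lipConst_le_of_lipschitzWith hg.lipschitzWith_uncurry_sqrt).trans_eq ?_
  rw [NNReal.coe_mul, Real.coe_toNNReal _ (Real.sqrt_nonneg _), NNReal.coe_ofNat]

theorem lipschitzWith_of_lipConst_le (hg : IsC4 g) {K : ℝ≥0} (hK : lipConst g ≤ K) :
    LipschitzWith K (Function.uncurry g) :=
  LipschitzWith.of_dist_le_mul fun p q =>
    (dist_le_lipConst_mul_of_lipschitzWith hg.lipschitzWith_uncurry_normC4 p q).trans
      (mul_le_mul_of_nonneg_right hK dist_nonneg)

end IsC4

/-! ### Suprema over a family of `C⁴` functions -/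

section Family

variable {ι : Type*} {G : ι → UnitAddCircle → UnitAddCircle → ℝ}

theorem bddAbove_range_normC0 (hG : ∀ i, IsC4 (G i))
    (hbdd : BddAbove (Set.range fun i => normC4 (G i))) :
    BddAbove (Set.range fun i => normC0 (G i)) :=
  hbdd.range_mono _ fun i => (hG i).normC0_le_normC4

theorem bddAbove_range_lipConst (hG : ∀ i, IsC4 (G i))
    (hbdd : BddAbove (Set.range fun i => normC4 (G i))) :
    BddAbove (Set.range fun i => lipConst (G i)) :=
  hbdd.range_mono _ fun i => by linarith [(hG i).lipConst_le_normC4, (hG i).normC4_nonneg]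

theorem iSup_lipConst_le_iSup_normC4 (hG : ∀ i, IsC4 (G i))
    (hbdd : BddAbove (Set.range fun i => normC4 (G i))) :
    ⨆ i, lipConst (G i) ≤ (⨆ i, normC4 (G i)) / 32 := by
  have hnonneg : 0 ≤ ⨆ i, normC4 (G i) := Real.iSup_nonneg fun i => (hG i).normC4_nonneg
  refine Real.iSup_le (fun i => (hG i).lipConst_le_normC4.trans ?_) (by positivity)
  gcongr
  exact le_ciSup hbdd i

theorem sq_iSup_lipConst_le (hG : ∀ i, IsC4 (G i))
    (hbdd : BddAbove (Set.range fun i => normC4 (G i))) :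
    (⨆ i, lipConst (G i)) ^ 2 ≤ 8 * (⨆ i, normC0 (G i)) * ⨆ i, normC4 (G i) := by
  have hnormC0 (i) : 0 ≤ normC0 (G i) := (abs_nonneg _).trans ((hG i).abs_le_normC0 0 0)
  have hC0 : 0 ≤ ⨆ i, normC0 (G i) := Real.iSup_nonneg hnormC0
  have hC4 : 0 ≤ ⨆ i, normC4 (G i) := Real.iSup_nonneg fun i => (hG i).normC4_nonneg
  have hsqrt : ⨆ i, lipConst (G i) ≤ 2 * √(2 * (⨆ i, normC0 (G i)) * ⨆ i, normC4 (G i)) := by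
    refine Real.iSup_le (fun i => (hG i).lipConst_le_sqrt.trans ?_) (by positivity)
    gcongr
    · exact (hG i).normC4_nonneg
    · exact le_ciSup (bddAbove_range_normC0 hG hbdd) i
    · exact le_ciSup hbdd i
  refine (pow_le_pow_left₀ (Real.iSup_nonneg fun i => lipConst_nonneg (G i)) hsqrt 2).trans_eq ?_
  rw [mul_pow, Real.sq_sqrt (by positivity)]
  ring

end Family

end C4

/-! ### Fourier coefficients of measures on the circle -/

theorem sum_range_inv_mul_sqrt_le (n : ℕ) :
    ∑ i ∈ Finset.range (n + 1), (((i : ℝ) + 1) * √((i : ℝ) + 1))⁻¹ ≤ 3 - 2 / √((n : ℝ) + 1) := by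
  induction n with
  | zero => norm_num
  | succ n ih =>
    rw [Finset.sum_range_succ]
    push_cast
    set a := √((n : ℝ) + 1)
    set b := √((n : ℝ) + 1 + 1)
    have ha0 : 0 < a := Real.sqrt_pos.2 (by positivity)
    have hab : a ≤ b := Real.sqrt_le_sqrt (by linarith)
    have hb0 : 0 < b := ha0.trans_le hab
    have hbsq : (n : ℝ) + 1 + 1 = b ^ 2 := (Real.sq_sqrt (by positivity)).symm
    have hasq : (n : ℝ) + 1 = a ^ 2 := (Real.sq_sqrt (by positivity)).symm
    have htelescope : 2 / a - 2 / b = 2 / (a * b * (b + a)) := by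
      have : (b - a) * (b + a) = 1 := by linear_combination hasq - hbsq
      field_simp
      linear_combination this
    have hterm : (b ^ 2 * b)⁻¹ ≤ 2 / (a * b * (b + a)) := by
      rw [inv_eq_one_div, div_le_div_iff₀ (by positivity) (by positivity)]
      have : b * (a * (b + a)) ≤ b * (b * (b + b)) := by gcongr
      linarith
    rw [hbsq]
    linarith

theorem tsum_inv_mul_sqrt_le :
    Summable (fun i : ℕ => (((i : ℝ) + 1) * √((i : ℝ) + 1))⁻¹) ∧
      ∑' i : ℕ, (((i : ℝ) + 1) * √((i : ℝ) + 1))⁻¹ ≤ 3 := by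
  have hpartial (n : ℕ) : ∑ i ∈ Finset.range n, (((i : ℝ) + 1) * √((i : ℝ) + 1))⁻¹ ≤ 3 := by
    rcases n with _ | n
    · simp
    · exact (sum_range_inv_mul_sqrt_le n).trans (sub_le_self _ (by positivity))
  exact ⟨summable_of_sum_range_le (fun i => by positivity) hpartial,
    Real.tsum_le_of_sum_range_le (fun i => by positivity) hpartial⟩

theorem tsum_mul_le_sqrt_tsum_mul_sqrt_tsum {ι : Type*} {u v : ι → ℝ} (hu : ∀ i, 0 ≤ u i)
    (hv : ∀ i, 0 ≤ v i) (hu2 : Summable fun i => u i ^ 2) (hv2 : Summable fun i => v i ^ 2) :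
    Summable (fun i => u i * v i) ∧
      ∑' i, u i * v i ≤ √(∑' i, u i ^ 2) * √(∑' i, v i ^ 2) := by
  have := Real.summable_and_inner_le_Lp_mul_Lq_tsum_of_nonneg Real.HolderConjugate.two_two hu hv
    (by simpa using hu2) (by simpa using hv2)
  simpa [Real.sqrt_eq_rpow] using this

section CircleFourier

variable {f : UnitAddCircle → ℂ} {B : ℝ}

theorem fourierCoeff_eq_fourierCoeffOn_zero_one (f : UnitAddCircle → ℂ) (k : ℤ) :
    fourierCoeff f k = fourierCoeffOn zero_lt_one (fun x : ℝ => f x) k := by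
  rw [fourierCoeff_eq_intervalIntegral f k 0, fourierCoeffOn_eq_integral]
  simp

theorem two_pi_mul_abs_mul_norm_fourierCoeff (hf : ContDiff ℝ 1 fun x : ℝ => f x) {k : ℤ}
    (hk : k ≠ 0) : 2 * Real.pi * (|(k : ℝ)| * ‖fourierCoeff f k‖) =
      ‖fourierCoeffOn zero_lt_one (deriv fun x : ℝ => f x) k‖ := by
  have hparts := fourierCoeffOn_of_hasDerivAt zero_lt_one hk
    (fun x _ => (hf.differentiable (by simp) x).hasDerivAt)
    ((hf.continuous_deriv le_rfl).intervalIntegrable 0 1)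
  have hends : f ((1 : ℝ) : UnitAddCircle) - f ((0 : ℝ) : UnitAddCircle) = 0 := by
    rw [AddCircle.coe_period, AddCircle.coe_zero, sub_self]
  have : (k : ℂ) ≠ 0 := Int.cast_ne_zero.2 hk
  rw [fourierCoeff_eq_fourierCoeffOn_zero_one, hparts, hends]
  simp [abs_of_pos Real.pi_pos]
  field_simp

theorem tsum_sq_abs_mul_norm_fourierCoeff_le (hf : ContDiff ℝ 1 fun x : ℝ => f x)
    (hB : ∀ x, ‖deriv (fun x : ℝ => f x) x‖ ≤ B) :
    Summable (fun k : ℤ => (|(k : ℝ)| * ‖fourierCoeff f k‖) ^ 2) ∧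
      ∑' k : ℤ, (|(k : ℝ)| * ‖fourierCoeff f k‖) ^ 2 ≤ (B / (2 * Real.pi)) ^ 2 := by
  have hcont := hf.continuous_deriv le_rfl
  have hparseval := hasSum_sq_fourierCoeffOn zero_lt_one
    (MemLp.of_bound hcont.aestronglyMeasurable B (Eventually.of_forall hB))
  have hint : ∫ x in (0 : ℝ)..1, ‖deriv (fun x : ℝ => f x) x‖ ^ 2 ≤ B ^ 2 := by
    refine (intervalIntegral.integral_mono_on (g := fun _ => B ^ 2) zero_le_one
      ((hcont.norm.pow 2).intervalIntegrable 0 1) (continuous_const.intervalIntegrable 0 1)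
      fun x _ => pow_le_pow_left₀ (norm_nonneg _) (hB x) 2).trans_eq (by simp)
  have hterm (k : ℤ) : (|(k : ℝ)| * ‖fourierCoeff f k‖) ^ 2 ≤ ((2 * Real.pi) ^ 2)⁻¹ *
      ‖fourierCoeffOn zero_lt_one (deriv fun x : ℝ => f x) k‖ ^ 2 := by
    rw [inv_mul_eq_div, le_div_iff₀' (by positivity), ← mul_pow]
    rcases eq_or_ne k 0 with rfl | hk
    · simp
    · rw [two_pi_mul_abs_mul_norm_fourierCoeff hf hk]
  have hsummable := Summable.of_nonneg_of_le (fun k => sq_nonneg _) hterm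
    (hparseval.summable.mul_left _)
  refine ⟨hsummable, (hsummable.tsum_le_tsum hterm (hparseval.summable.mul_left _)).trans ?_⟩
  rw [tsum_mul_left, hparseval.tsum_eq, div_pow, inv_mul_eq_div]
  gcongr
  simpa using hint

theorem summable_fourierCoeff_of_contDiff (hf : ContDiff ℝ 1 fun x : ℝ => f x)
    (hB : ∀ x, ‖deriv (fun x : ℝ => f x) x‖ ≤ B) : Summable (fourierCoeff f) := by
  have hinv : Summable fun k : ℤ => (|(k : ℝ)|⁻¹) ^ 2 := by
    simpa using Real.summable_one_div_int_pow.2 one_lt_two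
  refine Summable.of_norm_bounded_eventually (tsum_mul_le_sqrt_tsum_mul_sqrt_tsum
    (fun k => by positivity) (fun k => by positivity) hinv
    (tsum_sq_abs_mul_norm_fourierCoeff_le hf hB).1).1 ?_
  filter_upwards [(Set.finite_singleton (0 : ℤ)).compl_mem_cofinite] with k (hk : k ≠ 0)
  rw [inv_mul_cancel_left₀ (abs_ne_zero.2 (Int.cast_ne_zero.2 hk))]

theorem hasSum_fourierCoeff_mul_integral_fourier {f : C(UnitAddCircle, ℂ)}
    (hf : Summable (fourierCoeff f)) (μ : Measure UnitAddCircle) [IsFiniteMeasure μ] :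
    HasSum (fun k : ℤ => fourierCoeff f k * ∫ x, fourier k x ∂μ) (∫ x, f x ∂μ) := by
  simp only [← integral_const_mul]
  refine hasSum_integral_of_dominated_convergence (fun k _ => ‖fourierCoeff f k‖)
    (fun k => by fun_prop) (fun k => .of_forall fun x => ?_)
    (.of_forall fun _ => hf.norm) (integrable_const _)
    (.of_forall fun x => has_pointwise_sum_fourier_series_of_summable hf x)
  rw [norm_mul]
  exact mul_le_of_le_one_right (norm_nonneg _)
    (((fourier k).norm_coe_le_norm x).trans_eq (fourier_norm k))

/-- The derivative has `k`-th coefficient of size `2π|k|‖f̂(k)‖`, so this is the Cauchy–Schwarz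
inequality between `f'` and the negative Sobolev norm of `μ - ν`. The zero mode contributes
nothing, in agreement with `x / 0 = 0`. -/
theorem norm_integral_sub_integral_le_of_contDiff {f : C(UnitAddCircle, ℂ)}
    (hf : ContDiff ℝ 1 fun x : ℝ => f x) (hB : ∀ x, ‖deriv (fun x : ℝ => f x) x‖ ≤ B)
    {μ ν : Measure UnitAddCircle} [IsProbabilityMeasure μ] [IsProbabilityMeasure ν]
    (hμν : Summable fun k : ℤ =>
      (‖∫ x, fourier k x ∂μ - ∫ x, fourier k x ∂ν‖ / |(k : ℝ)|) ^ 2) :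
    ‖∫ x, f x ∂μ - ∫ x, f x ∂ν‖ ≤ B / (2 * Real.pi) *
      √(∑' k : ℤ, (‖∫ x, fourier k x ∂μ - ∫ x, fourier k x ∂ν‖ / |(k : ℝ)|) ^ 2) := by
  have hB0 : 0 ≤ B := (norm_nonneg _).trans (hB 0)
  obtain ⟨hf2, hf2le⟩ := tsum_sq_abs_mul_norm_fourierCoeff_le hf hB
  have hsummable := summable_fourierCoeff_of_contDiff hf hB
  have hseries := (hasSum_fourierCoeff_mul_integral_fourier hsummable μ).sub
    (hasSum_fourierCoeff_mul_integral_fourier hsummable ν)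
  obtain ⟨hprod, hprodle⟩ := tsum_mul_le_sqrt_tsum_mul_sqrt_tsum
    (fun k : ℤ => by positivity) (fun k : ℤ => by positivity) hf2 hμν
  rw [← hseries.tsum_eq]
  refine (tsum_of_norm_bounded hprod.hasSum fun k => ?_).trans (hprodle.trans ?_)
  · rcases eq_or_ne k 0 with rfl | hk
    · simp
    · rw [← mul_sub, norm_mul]
      have : |(k : ℝ)| ≠ 0 := abs_ne_zero.2 (Int.cast_ne_zero.2 hk)
      exact le_of_eq (by field_simp)
  · gcongr
    exact Real.sqrt_le_iff.2 ⟨by positivity, hf2le⟩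

theorem norm_integral_fourier_neg_sub (μ ν : Measure UnitAddCircle) (k : ℤ) :
    ‖∫ x, fourier (-k) x ∂μ - ∫ x, fourier (-k) x ∂ν‖ =
      ‖∫ x, fourier k x ∂μ - ∫ x, fourier k x ∂ν‖ := by
  simp only [fourier_neg, integral_conj, ← map_sub, RCLike.norm_conj]

theorem tsum_sq_norm_fourier_sub_div_le {μ ν : Measure UnitAddCircle} [IsProbabilityMeasure μ]
    [IsProbabilityMeasure ν] {τ : ℝ} (h : ∀ k : ℕ,
      ‖∫ x, fourier (k + 1 : ℕ) x ∂μ - ∫ x, fourier (k + 1 : ℕ) x ∂ν‖ ^ 2 ≤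
        2 * τ ^ 2 * √((k : ℝ) + 1)) :
    Summable (fun k : ℤ => (‖∫ x, fourier k x ∂μ - ∫ x, fourier k x ∂ν‖ / |(k : ℝ)|) ^ 2) ∧
      ∑' k : ℤ, (‖∫ x, fourier k x ∂μ - ∫ x, fourier k x ∂ν‖ / |(k : ℝ)|) ^ 2 ≤ 12 * τ ^ 2 := by
  set a : ℤ → ℝ := fun k => (‖∫ x, fourier k x ∂μ - ∫ x, fourier k x ∂ν‖ / |(k : ℝ)|) ^ 2 with ha
  have hterm (k : ℕ) : a (k + 1 : ℕ) ≤ 2 * τ ^ 2 * (((k : ℝ) + 1) * √((k : ℝ) + 1))⁻¹ := by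
    have habs : |(((k + 1 : ℕ) : ℤ) : ℝ)| = (k : ℝ) + 1 := by
      push_cast
      exact abs_of_nonneg (by positivity)
    have hsqrt : √((k : ℝ) + 1) ^ 2 = k + 1 := Real.sq_sqrt (by positivity)
    simp only [ha]
    rw [habs, div_pow, div_le_iff₀ (by positivity)]
    refine (h k).trans_eq ?_
    field_simp
    rw [hsqrt]
  obtain ⟨hweights, hweightsle⟩ := tsum_inv_mul_sqrt_le
  have hsummable : Summable fun k : ℕ => a (k + 1 : ℕ) :=
    Summable.of_nonneg_of_le (fun k => sq_nonneg _) hterm (hweights.mul_left _)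
  have hle : ∑' k : ℕ, a (k + 1 : ℕ) ≤ 6 * τ ^ 2 := by
    refine (hsummable.tsum_le_tsum hterm (hweights.mul_left _)).trans ?_
    rw [tsum_mul_left]
    nlinarith [sq_nonneg τ]
  have heven (k : ℤ) : a (-k) = a k := by
    simp only [ha, norm_integral_fourier_neg_sub, Int.cast_neg, abs_neg]
  have hnat : HasSum (fun k : ℕ => a k) (∑' k : ℕ, a (k + 1 : ℕ)) := by
    have hzero : a 0 = 0 := by simp [ha]
    refine (hasSum_nat_add_iff' 1).1 ?_
    rw [Finset.sum_range_one, Nat.cast_zero, hzero, sub_zero]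
    exact hsummable.hasSum
  have hint := hnat.of_nat_of_neg_add_one (f := a) (by
    simp only [heven]
    exact hsummable.hasSum)
  refine ⟨hint.summable, ?_⟩
  rw [hint.tsum_eq]
  linarith

theorem norm_deriv_ofReal_comp_le_of_lipschitzWith {ψ : UnitAddCircle → ℝ} {K : NNReal}
    (hψ : LipschitzWith K ψ) (x : ℝ) : ‖deriv (fun x : ℝ => (ψ x : ℂ)) x‖ ≤ K := by
  have hlift : LipschitzWith (1 * (K * 1)) fun x : ℝ => (ψ x : ℂ) :=
    Complex.isometry_ofReal.lipschitz.comp (hψ.comp lipschitzWith_coe_addCircle)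
  simpa only [one_mul, mul_one] using norm_deriv_le_of_lipschitz hlift

/-- The admissible growth `√k` of the squared modes works because `∑ √k / k² = ∑ k^(-3/2)`
converges. -/
theorem abs_integral_sub_integral_le_of_fourier {ψ : UnitAddCircle → ℝ}
    (hψ : ContDiff ℝ 1 fun x : ℝ => ψ x) {K : NNReal} (hlip : LipschitzWith K ψ)
    {μ ν : Measure UnitAddCircle} [IsProbabilityMeasure μ] [IsProbabilityMeasure ν] {τ : ℝ}
    (hτ : 0 ≤ τ) (h : ∀ k : ℕ,
      ‖∫ x, fourier (k + 1 : ℕ) x ∂μ - ∫ x, fourier (k + 1 : ℕ) x ∂ν‖ ^ 2 ≤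
        2 * τ ^ 2 * √((k : ℝ) + 1)) :
    |∫ x, ψ x ∂μ - ∫ x, ψ x ∂ν| ≤ 0.56 * K * τ := by
  let f : C(UnitAddCircle, ℂ) :=
    ⟨fun x => (ψ x : ℂ), Complex.continuous_ofReal.comp hlip.continuous⟩
  have hf : ContDiff ℝ 1 fun x : ℝ => f x := Complex.ofRealCLM.contDiff.comp hψ
  obtain ⟨hsummable, hle⟩ := tsum_sq_norm_fourier_sub_div_le h
  have hmain := norm_integral_sub_integral_le_of_contDiff hf
    (norm_deriv_ofReal_comp_le_of_lipschitzWith hlip) hsummable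
  have hcast : ∫ x, f x ∂μ - ∫ x, f x ∂ν = ((∫ x, ψ x ∂μ - ∫ x, ψ x ∂ν : ℝ) : ℂ) := by
    push_cast
    rw [← integral_complex_ofReal, ← integral_complex_ofReal]
    rfl
  rw [hcast, Complex.norm_real, Real.norm_eq_abs] at hmain
  have hsqrt : √(12 * τ ^ 2) ≤ 3.4642 * τ :=
    Real.sqrt_le_iff.2 ⟨by positivity, by nlinarith [sq_nonneg τ]⟩
  calc |∫ x, ψ x ∂μ - ∫ x, ψ x ∂ν|
      ≤ K / (2 * Real.pi) * (3.4642 * τ) := hmain.trans <| by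
        gcongr
        exact (Real.sqrt_le_sqrt hle).trans hsqrt
    _ ≤ K / (2 * 3.14) * (3.4642 * τ) := by
        gcongr
        exact Real.pi_gt_d2.le
    _ = 3.4642 / 6.28 * (K * τ) := by ring
    _ ≤ 0.56 * (K * τ) := by gcongr; norm_num
    _ = 0.56 * K * τ := by ring

end CircleFourier

/-! ### Random maps acting on measures -/

section Transfer

open scoped NNReal

variable {Ω M : Type*} [MeasurableSpace Ω] [MeasurableSpace M] {P : Measure Ω}
  {f : Ω → M → M} {m : Measure M}

/-- The dual Markov operator of the random map `f`: the law of `f ω x` when `ω` and `x` are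
independent with laws `P` and `m`. -/
noncomputable def transferMeasure (P : Measure Ω) (f : Ω → M → M) (m : Measure M) : Measure M :=
  (P.prod m).map fun p => f p.1 p.2

theorem isProbabilityMeasure_transferMeasure [IsProbabilityMeasure P] [IsProbabilityMeasure m]
    (hf : Measurable fun p : Ω × M => f p.1 p.2) : IsProbabilityMeasure (transferMeasure P f m) :=
  Measure.isProbabilityMeasure_map hf.aemeasurable

theorem transferMeasure_apply [SFinite P] [SFinite m]
    (hf : Measurable fun p : Ω × M => f p.1 p.2) {B : Set M} (hB : MeasurableSet B) :
    transferMeasure P f m B = ∫⁻ x, P {ω | f ω x ∈ B} ∂m := by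
  rw [transferMeasure, Measure.map_apply hf hB, Measure.prod_apply_symm (hf hB)]
  rfl

theorem transferMeasure_comp_measurePreserving [SFinite P] [SFinite m]
    (hf : Measurable fun p : Ω × M => f p.1 p.2) {T : Ω → Ω} (hT : MeasurePreserving T P P) :
    transferMeasure P (f ∘ T) m = transferMeasure P f m := by
  have hprod : (P.prod m).map (Prod.map T id) = P.prod m := by
    rw [← Measure.map_prod_map P m hT.measurable measurable_id, hT.map_eq, Measure.map_id]
  rw [transferMeasure, transferMeasure, ← hprod,
    Measure.map_map hf (hT.measurable.prodMap measurable_id), hprod]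
  rfl

theorem map_apply_eq_transferMeasure_of_indepFun [IsFiniteMeasure P] {Ω' : Type*}
    [MeasurableSpace Ω'] {X : Ω → Ω'} {Y : Ω → M} (hX : Measurable X) (hY : Measurable Y)
    (hind : IndepFun X Y P) {F : Ω' → M → M} (hF : Measurable fun p : Ω' × M => F p.1 p.2) :
    P.map (fun ω => F (X ω) (Y ω)) = transferMeasure P (F ∘ X) (P.map Y) := by
  have hjoint : P.map (fun ω => (X ω, Y ω)) = (P.prod (P.map Y)).map (Prod.map X id) := by
    rw [(indepFun_iff_map_prod_eq_prod_map_map hX.aemeasurable hY.aemeasurable).1 hind,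
      ← Measure.map_prod_map P (P.map Y) hX measurable_id, Measure.map_id]
  have := congrArg (Measure.map fun p : Ω' × M => F p.1 p.2) hjoint
  rwa [Measure.map_map hF (hX.prodMk hY), Measure.map_map hF (hX.prodMap measurable_id)] at this

theorem map_apply_eq_transferMeasure_of_indep {Ω M : Type*} {m₁ m₂ mΩ : MeasurableSpace Ω}
    [MeasurableSpace M] {P : Measure Ω} [IsFiniteMeasure P] (h₁ : m₁ ≤ mΩ) (h₂ : m₂ ≤ mΩ)
    (hind : Indep m₁ m₂ P) {f : Ω → M → M} {u : Ω → M}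
    (hf : Measurable[m₁.prod inferInstance] fun p : Ω × M => f p.1 p.2) (hu : Measurable[m₂] u) :
    P.map (fun ω => f ω (u ω)) = transferMeasure P f (P.map u) := by
  have hindep : @IndepFun Ω Ω M mΩ m₁ _ id u P := by
    refine (@IndepFun_iff_Indep Ω Ω M mΩ m₁ _ id u P).2 ?_
    rw [MeasurableSpace.comap_id]
    exact indep_of_indep_of_le_right hind hu.comap_le
  exact @map_apply_eq_transferMeasure_of_indepFun Ω M mΩ _ P _ Ω m₁ id u
    (measurable_id.mono h₁ le_rfl) (hu.mono h₂ le_rfl) hindep f hf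

theorem isProbabilityMeasure_iterate_transferMeasure [IsProbabilityMeasure P]
    [IsProbabilityMeasure m] (hf : Measurable fun p : Ω × M => f p.1 p.2) (n : ℕ) :
    IsProbabilityMeasure ((transferMeasure P f)^[n] m) := by
  induction n with
  | zero => assumption
  | succ n ih =>
    rw [Function.iterate_succ_apply']
    exact isProbabilityMeasure_transferMeasure hf

variable [PseudoMetricSpace M] [OpensMeasurableSpace M] {g : M → ℝ} {K C : ℝ≥0} {D : ℝ}

theorem integrable_comp_of_lipschitzWith [IsFiniteMeasure P] (hD : ∀ x y : M, dist x y ≤ D)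
    (hg : LipschitzWith K g) {u : Ω → M} (hu : Measurable u) : Integrable (fun ω => g (u ω)) P := by
  rcases isEmpty_or_nonempty Ω with hΩ | ⟨⟨ω₀⟩⟩
  · exact Integrable.of_isEmpty
  · refine Integrable.of_bound (C := ‖g (u ω₀)‖ + K * D)
      (hg.continuous.measurable.comp hu).aestronglyMeasurable (Eventually.of_forall fun ω => ?_)
    calc ‖g (u ω)‖ ≤ ‖g (u ω₀)‖ + dist (g (u ω)) (g (u ω₀)) := by
          rw [dist_eq_norm]
          exact norm_le_norm_add_norm_sub' _ _
      _ ≤ ‖g (u ω₀)‖ + K * D := by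
          gcongr
          exact (hg.dist_le_mul _ _).trans (by gcongr; exact hD _ _)

theorem dist_integral_le_of_lipschitzWith (hD : ∀ x y : M, dist x y ≤ D) (hg : LipschitzWith K g)
    (μ ν : Measure M) [IsProbabilityMeasure μ] [IsProbabilityMeasure ν] :
    dist (∫ x, g x ∂μ) (∫ y, g y ∂ν) ≤ K * D := by
  have hint (m : Measure M) [IsProbabilityMeasure m] : Integrable g m :=
    integrable_comp_of_lipschitzWith hD hg measurable_id
  have hinner (x : M) : dist (g x) (∫ y, g y ∂ν) ≤ K * D := by
    have : g x - ∫ y, g y ∂ν = ∫ y, (g x - g y) ∂ν := by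
      rw [integral_sub (integrable_const _) (hint ν), integral_const, probReal_univ, one_smul]
    rw [dist_eq_norm, this]
    refine (norm_integral_le_of_norm_le_const (C := K * D) (.of_forall fun y => ?_)).trans_eq
      (by simp)
    rw [← dist_eq_norm]
    exact (hg.dist_le_mul x y).trans (by gcongr; exact hD x y)
  have : ∫ x, g x ∂μ - ∫ y, g y ∂ν = ∫ x, (g x - ∫ y, g y ∂ν) ∂μ := by
    rw [integral_sub (hint μ) (integrable_const _), integral_const, probReal_univ, one_smul]
  rw [dist_eq_norm, this]
  refine (norm_integral_le_of_norm_le_const (C := K * D) (.of_forall fun x => ?_)).trans_eq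
    (by simp)
  rw [← dist_eq_norm]
  exact hinner x

variable [IsProbabilityMeasure P]

theorem integral_transferMeasure [IsProbabilityMeasure m] (hD : ∀ x y : M, dist x y ≤ D)
    (hf : Measurable fun p : Ω × M => f p.1 p.2) (hg : LipschitzWith K g) :
    ∫ y, g y ∂transferMeasure P f m = ∫ x, ∫ ω, g (f ω x) ∂P ∂m := by
  rw [transferMeasure, integral_map hf.aemeasurable hg.continuous.measurable.aestronglyMeasurable]
  exact integral_prod_symm _ (integrable_comp_of_lipschitzWith hD hg hf)

theorem lipschitzWith_integral_comp (hD : ∀ x y : M, dist x y ≤ D)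
    (hf : Measurable fun p : Ω × M => f p.1 p.2) (hC : ∀ ω, LipschitzWith C (f ω))
    (hg : LipschitzWith K g) : LipschitzWith (K * C) fun x => ∫ ω, g (f ω x) ∂P := by
  have hint (x : M) : Integrable (fun ω => g (f ω x)) P :=
    integrable_comp_of_lipschitzWith hD hg (hf.comp (measurable_id.prodMk measurable_const))
  refine LipschitzWith.of_dist_le_mul fun x y => ?_
  rw [dist_eq_norm, ← integral_sub (hint x) (hint y)]
  refine (norm_integral_le_of_norm_le_const (C := (K * C : ℝ≥0) * dist x y)
    (.of_forall fun ω => ?_)).trans_eq (by simp)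
  rw [← dist_eq_norm]
  exact (hg.comp (hC ω)).dist_le_mul x y

theorem dist_integral_iterate_transferMeasure_le (hD : ∀ x y : M, dist x y ≤ D)
    (hf : Measurable fun p : Ω × M => f p.1 p.2) (hC : ∀ ω, LipschitzWith C (f ω))
    (hg : LipschitzWith K g) (μ ν : Measure M) [IsProbabilityMeasure μ] [IsProbabilityMeasure ν]
    (n : ℕ) :
    dist (∫ x, g x ∂(transferMeasure P f)^[n] μ) (∫ x, g x ∂(transferMeasure P f)^[n] ν) ≤
      K * C ^ n * D := by
  induction n generalizing g K with
  | zero => simpa using dist_integral_le_of_lipschitzWith hD hg μ ν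
  | succ n ih =>
    have hμ := isProbabilityMeasure_iterate_transferMeasure (P := P) (m := μ) hf n
    have hν := isProbabilityMeasure_iterate_transferMeasure (P := P) (m := ν) hf n
    rw [Function.iterate_succ_apply', Function.iterate_succ_apply',
      integral_transferMeasure hD hf hg, integral_transferMeasure hD hf hg]
    refine (ih (lipschitzWith_integral_comp hD hf hC hg)).trans_eq ?_
    rw [NNReal.coe_mul]
    ring

end Transfer

theorem eq_of_forall_integral_lipschitz_eq {M : Type*} [MeasurableSpace M] [EMetricSpace M]
    [BorelSpace M] {μ ν : Measure M} [IsProbabilityMeasure μ] [IsProbabilityMeasure ν]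
    (h : ∀ (g : M → ℝ) (K : NNReal), LipschitzWith K g → ∫ x, g x ∂μ = ∫ x, g x ∂ν) : μ = ν := by
  let μ' : ProbabilityMeasure M := ⟨μ, inferInstance⟩
  let ν' : ProbabilityMeasure M := ⟨ν, inferInstance⟩
  have hconst : Tendsto (fun _ : ℕ => μ') atTop (nhds ν') := by
    refine tendsto_iff_forall_lipschitz_integral_tendsto.2 fun g _ ⟨K, hK⟩ => ?_
    change Tendsto (fun _ : ℕ => ∫ x, g x ∂μ) atTop (nhds (∫ x, g x ∂ν))
    rw [h g K hK]
    exact tendsto_const_nhds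
  have heq : μ' = ν' := tendsto_nhds_unique tendsto_const_nhds hconst
  exact congrArg Subtype.val heq

/-! ### The σ-algebras of the node maps and the coding map -/

section NodeSigma

open scoped NNReal

variable {Ω ι : Type*} {θ : Ω → Ω} {φ : ι → ℕ → Ω → UnitAddCircle → UnitAddCircle} {K : ℝ≥0}
  {S : Set (ℕ × ι)}

/-- The σ-algebra generated by the maps `φ i 1 (θ^t ω)` with `(t, i) ∈ S`; random variables
measurable for disjoint `S` are independent. -/
@[reducible]
def nodeSigma (θ : Ω → Ω) (φ : ι → ℕ → Ω → UnitAddCircle → UnitAddCircle) (S : Set (ℕ × ι)) :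
    MeasurableSpace Ω :=
  ⨆ p ∈ S, MeasurableSpace.comap
    (fun (ω : Ω) (x : UnitAddCircle) => φ p.2 1 (θ^[p.1] ω) x) inferInstance

theorem measurable_nodeSigma_apply {t : ℕ} {i : ι} (hS : (t, i) ∈ S) (x : UnitAddCircle) :
    Measurable[nodeSigma θ φ S] fun ω => φ i 1 (θ^[t] ω) x := by
  have hmap : Measurable[nodeSigma θ φ S]
      fun (ω : Ω) (x : UnitAddCircle) => φ i 1 (θ^[t] ω) x :=
    measurable_iff_comap_le.2 (le_biSup (fun p : ℕ × ι => MeasurableSpace.comap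
      (fun (ω : Ω) (x : UnitAddCircle) => φ p.2 1 (θ^[p.1] ω) x) inferInstance) hS)
  exact (measurable_pi_apply x).comp hmap

theorem measurable_nodeSigma_uncurry (hcont : ∀ i ω, Continuous (φ i 1 ω)) {t : ℕ} {i : ι}
    (hS : (t, i) ∈ S) : Measurable[(nodeSigma θ φ S).prod inferInstance]
      fun q : Ω × UnitAddCircle => φ i 1 (θ^[t] q.1) q.2 := by
  let _ : MeasurableSpace Ω := nodeSigma θ φ S
  have := measurable_uncurry_of_continuous_of_measurable (u := fun x ω => φ i 1 (θ^[t] ω) x)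
    (fun ω => hcont i _) (measurable_nodeSigma_apply hS)
  exact this.comp measurable_swap

theorem measurable_nodeSigma_comp (hcont : ∀ i ω, Continuous (φ i 1 ω)) {t : ℕ} {i : ι}
    (hS : (t, i) ∈ S) {u : Ω → UnitAddCircle} (hu : Measurable[nodeSigma θ φ S] u) :
    Measurable[nodeSigma θ φ S] fun ω => φ i 1 (θ^[t] ω) (u ω) := by
  let _ : MeasurableSpace Ω := nodeSigma θ φ S
  exact (measurable_nodeSigma_uncurry hcont hS).comp (measurable_id.prodMk hu)

theorem measurable_nodeSigma_backwardIterate (hcont : ∀ i ω, Continuous (φ i 1 ω)) {i : ι} {s : ℕ}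
    (hS : ∀ k, (s + k, i) ∈ S) (p : UnitAddCircle) (n : ℕ) :
    Measurable[nodeSigma θ φ S] fun ω => backwardIterate θ (φ i) p n (θ^[s] ω) := by
  induction n generalizing s with
  | zero => exact measurable_const
  | succ n ih =>
    have hS' (k : ℕ) : (s + 1 + k, i) ∈ S := by simpa only [add_assoc, add_comm 1] using hS (k + 1)
    simpa only [backwardIterate, Function.iterate_succ_apply'] using
      measurable_nodeSigma_comp hcont (by simpa using hS 0 : (s, i) ∈ S) (ih hS')

theorem dist_backwardIterate_succ_le {ψ : ℕ → Ω → UnitAddCircle → UnitAddCircle}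
    (hK : ∀ ω, LipschitzWith K (ψ 1 ω)) (p : UnitAddCircle) (n : ℕ) (ω : Ω) :
    dist (backwardIterate θ ψ p n ω) (backwardIterate θ ψ p (n + 1) ω) ≤ 1 / 2 * (K : ℝ) ^ n := by
  induction n generalizing ω with
  | zero => simpa using dist_unitAddCircle_le_half _ _
  | succ n ih =>
    calc dist (backwardIterate θ ψ p (n + 1) ω) (backwardIterate θ ψ p (n + 2) ω)
        ≤ K * (1 / 2 * (K : ℝ) ^ n) := ((hK ω).dist_le_mul _ _).trans (by gcongr; exact ih _)
      _ = 1 / 2 * (K : ℝ) ^ (n + 1) := by ring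

theorem tendsto_backwardIterate_codingMap {ψ : ℕ → Ω → UnitAddCircle → UnitAddCircle}
    (hK1 : K < 1) (hK : ∀ ω, LipschitzWith K (ψ 1 ω)) (ω : Ω) :
    Tendsto (fun n => backwardIterate θ ψ 0 n ω) atTop (nhds (codingMap θ ψ ω)) :=
  (cauchySeq_of_le_geometric K (1 / 2) hK1 fun n =>
    dist_backwardIterate_succ_le hK 0 n ω).tendsto_limUnder

theorem apply_codingMap {ψ : ℕ → Ω → UnitAddCircle → UnitAddCircle} (hK1 : K < 1)
    (hK : ∀ ω, LipschitzWith K (ψ 1 ω)) (ω : Ω) :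
    ψ 1 ω (codingMap θ ψ (θ ω)) = codingMap θ ψ ω :=
  tendsto_nhds_unique
    (((hK ω).continuous.tendsto _).comp (tendsto_backwardIterate_codingMap hK1 hK (θ ω)))
    ((tendsto_backwardIterate_codingMap hK1 hK ω).comp (tendsto_add_atTop_nat 1))

theorem measurable_nodeSigma_codingMap (hK1 : K < 1) (hK : ∀ i ω, LipschitzWith K (φ i 1 ω))
    {i : ι} {s : ℕ} (hS : ∀ k, (s + k, i) ∈ S) :
    Measurable[nodeSigma θ φ S] fun ω => codingMap θ (φ i) (θ^[s] ω) := by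
  let _ : MeasurableSpace Ω := nodeSigma θ φ S
  exact measurable_of_tendsto_metrizable
    (fun n => measurable_nodeSigma_backwardIterate (fun i ω => (hK i ω).continuous) hS 0 n)
    (tendsto_pi_nhds.2 fun ω => tendsto_backwardIterate_codingMap hK1 (hK i) (θ^[s] ω))

variable [MeasurableSpace Ω]

theorem IsRDS.succ {M : Type*} [MeasurableSpace M] {ψ : ℕ → Ω → M → M} (hψ : IsRDS θ ψ) (n : ℕ)
    (ω : Ω) (x : M) : ψ (n + 1) ω x = ψ 1 (θ^[n] ω) (ψ n ω x) := by
  rw [add_comm, hψ.add]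

theorem IsRDS.measurable_apply {M : Type*} [MeasurableSpace M] {ψ : ℕ → Ω → M → M}
    (hψ : IsRDS θ ψ) (n : ℕ) (x : M) : Measurable fun ω => ψ n ω x :=
  (hψ.measurable n).comp (measurable_id.prodMk measurable_const)

theorem measurable_nodeSigma_flow (hrds : ∀ i, IsRDS θ (φ i))
    (hcont : ∀ i ω, Continuous (φ i 1 ω)) {i : ι} {s n : ℕ} (hS : ∀ k < n, (s + k, i) ∈ S)
    (x : UnitAddCircle) : Measurable[nodeSigma θ φ S] fun ω => φ i n (θ^[s] ω) x := by
  induction n with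
  | zero =>
    simp only [(hrds i).zero]
    exact measurable_const
  | succ n ih =>
    have hsucc : (fun ω => φ i (n + 1) (θ^[s] ω) x) =
        fun ω => φ i 1 (θ^[s + n] ω) (φ i n (θ^[s] ω) x) := by
      ext1 ω
      rw [(hrds i).succ, ← Function.iterate_add_apply, add_comm n s]
    rw [hsucc]
    exact measurable_nodeSigma_comp hcont (hS n n.lt_succ_self)
      (ih fun k hk => hS k (hk.trans n.lt_succ_self))

variable {P : Measure Ω}

theorem comap_node_le (hθ : Measurable θ) (hrds : ∀ i, IsRDS θ (φ i)) (p : ℕ × ι) :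
    MeasurableSpace.comap (fun (ω : Ω) (x : UnitAddCircle) => φ p.2 1 (θ^[p.1] ω) x) inferInstance
      ≤ ‹MeasurableSpace Ω› :=
  (measurable_pi_iff.2 fun x => ((hrds p.2).measurable_apply 1 x).comp (hθ.iterate p.1)).comap_le

theorem nodeSigma_le (hθ : Measurable θ) (hrds : ∀ i, IsRDS θ (φ i)) (S : Set (ℕ × ι)) :
    nodeSigma θ φ S ≤ ‹MeasurableSpace Ω› :=
  iSup₂_le fun p _ => comap_node_le hθ hrds p

theorem IIDNodeMaps.indep_nodeSigma (hnodes : IIDNodeMaps P θ φ) (hθ : Measurable θ)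
    (hrds : ∀ i, IsRDS θ (φ i)) {T : Set (ℕ × ι)} (hST : Disjoint S T) :
    Indep (nodeSigma θ φ S) (nodeSigma θ φ T) P :=
  indep_iSup_of_disjoint (comap_node_le hθ hrds) hnodes.indep hST

end NodeSigma

/-! ### Stationary measures of the node chains -/

section Stationary

open scoped NNReal

variable {Ω ι : Type*} [MeasurableSpace Ω] {P : Measure Ω} [IsProbabilityMeasure P] {θ : Ω → Ω}
  {φ : ι → ℕ → Ω → UnitAddCircle → UnitAddCircle} {K : ℝ≥0}

theorem IsStationaryMeasure.transferMeasure_eq {M : Type*} [MeasurableSpace M]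
    {ψ : ℕ → Ω → M → M} {m : Measure M} (hm : IsStationaryMeasure P ψ m)
    (hψ : Measurable fun p : Ω × M => ψ 1 p.1 p.2) : transferMeasure P (ψ 1) m = m := by
  have := hm.isProb
  ext B hB
  rw [transferMeasure_apply hψ hB, hm.stationary B hB]

theorem IIDNodeMaps.transferMeasure_eq (hnodes : IIDNodeMaps P θ φ) (hrds : ∀ i, IsRDS θ (φ i))
    (i j : ι) (m : Measure UnitAddCircle) [SFinite m] :
    transferMeasure P (φ i 1) m = transferMeasure P (φ j 1) m := by
  ext B hB
  rw [transferMeasure_apply ((hrds i).measurable 1) hB,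
    transferMeasure_apply ((hrds j).measurable 1) hB]
  exact lintegral_congr fun x =>
    ((hnodes.ident (0, i) (0, j)).comp (measurable_pi_apply x)).measure_mem_eq hB

theorem transferMeasure_codingMeasure (hθ : MeasurePreserving θ P P)
    (hrds : ∀ i, IsRDS θ (φ i)) (hK1 : K < 1) (hK : ∀ i ω, LipschitzWith K (φ i 1 ω))
    (hnodes : IIDNodeMaps P θ φ) (i : ι) :
    transferMeasure P (φ i 1) (codingMeasure P θ (φ i)) = codingMeasure P θ (φ i) := by
  have hle := nodeSigma_le hθ.measurable hrds
  have hmeas : Measurable (codingMap θ (φ i)) :=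
    (measurable_nodeSigma_codingMap (s := 0) hK1 hK fun _ => Set.mem_univ _).mono (hle _) le_rfl
  have hpast : Measurable[nodeSigma θ φ {q | 1 ≤ q.1}] fun ω => codingMap θ (φ i) (θ ω) :=
    measurable_nodeSigma_codingMap (s := 1) hK1 hK fun k => by simp
  have hind := hnodes.indep_nodeSigma hθ.measurable hrds (S := {(0, i)}) (T := {q | 1 ≤ q.1})
    (by simp)
  have hlaw : P.map (fun ω => codingMap θ (φ i) (θ ω)) = codingMeasure P θ (φ i) := by
    conv_rhs => rw [codingMeasure, ← hθ.map_eq, Measure.map_map hmeas hθ.measurable]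
    rfl
  have hmap := map_apply_eq_transferMeasure_of_indep (hle _) (hle _) hind
    (measurable_nodeSigma_uncurry (fun i ω => (hK i ω).continuous) (Set.mem_singleton (0, i))) hpast
  simp only [apply_codingMap hK1 (hK i), hlaw] at hmap
  exact hmap.symm

theorem isProbabilityMeasure_codingMeasure (hθ : Measurable θ) (hrds : ∀ i, IsRDS θ (φ i))
    (hK1 : K < 1) (hK : ∀ i ω, LipschitzWith K (φ i 1 ω)) (i : ι) :
    IsProbabilityMeasure (codingMeasure P θ (φ i)) :=
  Measure.isProbabilityMeasure_map ((measurable_nodeSigma_codingMap (s := 0) hK1 hK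
    fun _ => Set.mem_univ _).mono (nodeSigma_le hθ hrds _) le_rfl).aemeasurable

theorem isStationaryMeasure_codingMeasure (hθ : MeasurePreserving θ P P)
    (hrds : ∀ i, IsRDS θ (φ i)) (hK1 : K < 1) (hK : ∀ i ω, LipschitzWith K (φ i 1 ω))
    (hnodes : IIDNodeMaps P θ φ) (i j : ι) :
    IsStationaryMeasure P (φ i) (codingMeasure P θ (φ j)) := by
  have hprob := isProbabilityMeasure_codingMeasure (P := P) hθ.measurable hrds hK1 hK j
  refine ⟨hprob, fun B hB => ?_⟩
  rw [← transferMeasure_apply ((hrds i).measurable 1) hB, hnodes.transferMeasure_eq hrds i j,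
    transferMeasure_codingMeasure hθ hrds hK1 hK hnodes]

theorem IsStationaryMeasure.eq {ψ : ℕ → Ω → UnitAddCircle → UnitAddCircle}
    (hψ : Measurable fun p : Ω × UnitAddCircle => ψ 1 p.1 p.2) (hK1 : K < 1)
    (hK : ∀ ω, LipschitzWith K (ψ 1 ω)) {μ ν : Measure UnitAddCircle}
    (hμ : IsStationaryMeasure P ψ μ) (hν : IsStationaryMeasure P ψ ν) : μ = ν := by
  have := hμ.isProb
  have := hν.isProb
  refine eq_of_forall_integral_lipschitz_eq fun g C hg => dist_le_zero.1 ?_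
  have hlim : Tendsto (fun n : ℕ => C * (K : ℝ) ^ n * (1 / 2)) atTop (nhds 0) := by
    simpa using ((tendsto_pow_atTop_nhds_zero_of_lt_one K.2 hK1).const_mul (C : ℝ)).mul_const _
  refine ge_of_tendsto' hlim fun n => ?_
  have := dist_integral_iterate_transferMeasure_le (P := P) dist_unitAddCircle_le_half hψ hK hg
    μ ν n
  rwa [Function.iterate_fixed (hμ.transferMeasure_eq hψ),
    Function.iterate_fixed (hν.transferMeasure_eq hψ)] at this

/-! ### The law of an uncoupled node -/

theorem map_flow_eq_iterate_transferMeasure (hθ : MeasurePreserving θ P P)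
    (hrds : ∀ i, IsRDS θ (φ i)) (hcont : ∀ i ω, Continuous (φ i 1 ω))
    (hnodes : IIDNodeMaps P θ φ) (i : ι) (n : ℕ) (x : UnitAddCircle) :
    P.map (fun ω => φ i n ω x) = (transferMeasure P (φ i 1))^[n] (Measure.dirac x) := by
  induction n with
  | zero => simp [(hrds i).zero]
  | succ n ih =>
    have hle := nodeSigma_le hθ.measurable hrds
    have hpast : Measurable[nodeSigma θ φ {q | q.1 < n}] fun ω => φ i n ω x :=
      measurable_nodeSigma_flow (s := 0) hrds hcont (fun k hk => by simpa using hk) x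
    have hind := hnodes.indep_nodeSigma hθ.measurable hrds (S := {(n, i)}) (T := {q | q.1 < n})
      (by simp)
    have := Measure.isProbabilityMeasure_map
      ((hrds i).measurable_apply n x).aemeasurable (μ := P)
    rw [Function.iterate_succ_apply', ← ih, ← transferMeasure_comp_measurePreserving
      ((hrds i).measurable 1) (hθ.iterate n)]
    have hsucc : (fun ω => φ i (n + 1) ω x) = fun ω => φ i 1 (θ^[n] ω) (φ i n ω x) :=
      funext fun ω => (hrds i).succ n ω x
    rw [hsucc]
    exact map_apply_eq_transferMeasure_of_indep (hle _) (hle _) hind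
      (measurable_nodeSigma_uncurry hcont (Set.mem_singleton (n, i))) hpast

theorem dist_integral_map_flow_le (hθ : MeasurePreserving θ P P) (hrds : ∀ i, IsRDS θ (φ i))
    (hK : ∀ i ω, LipschitzWith K (φ i 1 ω)) (hnodes : IIDNodeMaps P θ φ) {i : ι}
    {m : Measure UnitAddCircle} (hm : IsStationaryMeasure P (φ i) m) {g : UnitAddCircle → ℝ}
    {C : ℝ≥0} (hg : LipschitzWith C g) (n : ℕ) (x : UnitAddCircle) :
    dist (∫ y, g y ∂P.map fun ω => φ i n ω x) (∫ y, g y ∂m) ≤ C * K ^ n * (1 / 2) := by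
  have := hm.isProb
  have hbound := dist_integral_iterate_transferMeasure_le (P := P) dist_unitAddCircle_le_half
    ((hrds i).measurable 1) (hK i) hg (Measure.dirac x) m n
  rwa [Function.iterate_fixed (hm.transferMeasure_eq ((hrds i).measurable 1)),
    ← map_flow_eq_iterate_transferMeasure hθ hrds (fun i ω => (hK i ω).continuous) hnodes]
    at hbound

end Stationary

/-! ### Concentration of empirical measures -/

theorem iIndepFun_of_measurable_nodeSigma {Ω ι β : Type*} [MeasurableSpace Ω] [MeasurableSpace β]
    {P : Measure Ω} [IsProbabilityMeasure P] {θ : Ω → Ω}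
    {φ : ι → ℕ → Ω → UnitAddCircle → UnitAddCircle} (hθ : Measurable θ)
    (hrds : ∀ i, IsRDS θ (φ i)) (hnodes : IIDNodeMaps P θ φ) {w : ι → Ω → β}
    (hw : ∀ j, Measurable[nodeSigma θ φ {q | q.2 = j}] (w j)) : iIndepFun w P := by
  classical
  rw [iIndepFun_iff_measure_inter_preimage_eq_mul]
  intro S sets hsets
  induction S using Finset.induction_on with
  | empty => simp
  | insert a S ha ih =>
    rw [Finset.set_biInter_insert, Finset.prod_insert ha,
      ← ih fun i hi => hsets i (Finset.mem_insert_of_mem hi)]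
    have hdisj : Disjoint {q : ℕ × ι | q.2 = a} {q | q.2 ∈ S} :=
      Set.disjoint_left.2 fun q (hqa : q.2 = a) hqS => ha (hqa ▸ hqS)
    have hle {j : ι} (hj : j ∈ S) : nodeSigma θ φ {q | q.2 = j} ≤ nodeSigma θ φ {q | q.2 ∈ S} :=
      biSup_mono fun q (hq : q.2 = j) => show q.2 ∈ S from hq ▸ hj
    refine (Indep_iff _ _ P).1 (hnodes.indep_nodeSigma hθ hrds hdisj) _ _
      (hw a (hsets a (Finset.mem_insert_self a S))) ?_
    exact @Finset.measurableSet_biInter Ω ι (nodeSigma θ φ {q | q.2 ∈ S}) _ S fun j hj =>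
      hle hj _ (hw j (hsets j (Finset.mem_insert_of_mem hj)))

section Hoeffding

variable {Ω ι : Type*} [MeasurableSpace Ω] {P : Measure Ω} [IsProbabilityMeasure P] [Fintype ι]

theorem measureReal_le_sum_sub_integral_le {X : ι → Ω → ℝ} (hX : ∀ j, AEMeasurable (X j) P)
    (hind : iIndepFun X P) (hb : ∀ j ω, |X j ω| ≤ 1) {c : ℝ} (hc : 0 ≤ c) :
    P.real {ω | c ≤ ∑ j, (X j ω - ∫ ω', X j ω' ∂P)} ≤
      Real.exp (-(c ^ 2 / (2 * Fintype.card ι))) := by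
  have hvar : (‖(1 : ℝ) - -1‖₊ / 2) ^ 2 = 1 := by
    rw [sub_neg_eq_add, one_add_one_eq_two, Real.nnnorm_two, div_self two_ne_zero, one_pow]
  have hsub (j : ι) : HasSubgaussianMGF (fun ω => X j ω - ∫ ω', X j ω' ∂P) 1 P :=
    hvar ▸ hasSubgaussianMGF_of_mem_Icc (hX j) (.of_forall fun ω => abs_le.1 (hb j ω))
  have hindep : iIndepFun (fun j ω => X j ω - ∫ ω', X j ω' ∂P) P :=
    hind.comp (fun j x => x - ∫ ω', X j ω' ∂P) fun j => measurable_id.sub_const _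
  refine (HasSubgaussianMGF.measure_sum_ge_le_of_iIndepFun hindep (s := Finset.univ)
    (c := fun _ => 1) (fun j _ => hsub j) hc).trans_eq ?_
  simp [neg_div]

theorem measureReal_le_abs_sum_sub_integral_le {X : ι → Ω → ℝ} (hX : ∀ j, AEMeasurable (X j) P)
    (hind : iIndepFun X P) (hb : ∀ j ω, |X j ω| ≤ 1) {c : ℝ} (hc : 0 ≤ c) :
    P.real {ω | c ≤ |∑ j, (X j ω - ∫ ω', X j ω' ∂P)|} ≤
      2 * Real.exp (-(c ^ 2 / (2 * Fintype.card ι))) := by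
  have hupper := measureReal_le_sum_sub_integral_le hX hind hb hc
  have hlower := measureReal_le_sum_sub_integral_le (X := fun j ω => -X j ω) (fun j => (hX j).neg)
    (hind.comp (fun _ x => -x) fun _ => measurable_neg) (fun j ω => by simpa using hb j ω) hc
  have hneg (ω : Ω) : ∑ j, (-X j ω - ∫ ω', -X j ω' ∂P) = -∑ j, (X j ω - ∫ ω', X j ω' ∂P) := by
    rw [← Finset.sum_neg_distrib]
    exact Finset.sum_congr rfl fun j _ => by rw [integral_neg]; ring
  simp only [hneg] at hlower
  simp only [le_abs, Set.ofPred_or]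
  linarith [measureReal_union_le (μ := P) {ω | c ≤ ∑ j, (X j ω - ∫ ω', X j ω' ∂P)}
    {ω | c ≤ -∑ j, (X j ω - ∫ ω', X j ω' ∂P)}]

theorem measureReal_lt_sq_norm_sum_sub_integral_le {Z : ι → Ω → ℂ} (hZ : ∀ j, AEMeasurable (Z j) P)
    (hind : iIndepFun Z P) (hb : ∀ j ω, ‖Z j ω‖ ≤ 1) {v : ℝ} (hv : 0 ≤ v) :
    P.real {ω | 2 * v < ‖∑ j, (Z j ω - ∫ ω', Z j ω' ∂P)‖ ^ 2} ≤
      4 * Real.exp (-(v / (2 * Fintype.card ι))) := by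
  have hint (j : ι) : Integrable (Z j) P :=
    .of_bound (hZ j).aestronglyMeasurable 1 (.of_forall (hb j))
  have hre := measureReal_le_abs_sum_sub_integral_le
    (fun j => Complex.measurable_re.comp_aemeasurable (hZ j))
    (hind.comp (fun _ => Complex.re) fun _ => Complex.measurable_re)
    (fun j ω => (Complex.abs_re_le_norm _).trans (hb j ω)) (Real.sqrt_nonneg v)
  have him := measureReal_le_abs_sum_sub_integral_le
    (fun j => Complex.measurable_im.comp_aemeasurable (hZ j))
    (hind.comp (fun _ => Complex.im) fun _ => Complex.measurable_im)
    (fun j ω => (Complex.abs_im_le_norm _).trans (hb j ω)) (Real.sqrt_nonneg v)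
  rw [Real.sq_sqrt hv] at hre him
  have hsub : {ω | 2 * v < ‖∑ j, (Z j ω - ∫ ω', Z j ω' ∂P)‖ ^ 2} ⊆
      {ω | √v ≤ |∑ j, ((Z j ω).re - ∫ ω', (Z j ω').re ∂P)|} ∪
        {ω | √v ≤ |∑ j, ((Z j ω).im - ∫ ω', (Z j ω').im ∂P)|} := by
    intro ω hω
    have hre' (j : ι) : ∫ ω', (Z j ω').re ∂P = (∫ ω', Z j ω' ∂P).re := integral_re (hint j)
    have him' (j : ι) : ∫ ω', (Z j ω').im ∂P = (∫ ω', Z j ω' ∂P).im := integral_im (hint j)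
    simp only [Set.mem_union, Set.mem_ofPred_eq, hre', him', ← Complex.sub_re, ← Complex.sub_im,
      ← Complex.re_sum, ← Complex.im_sum, Complex.sq_norm, Complex.normSq_apply] at hω ⊢
    by_contra! hsmall
    have hre_lt := Real.lt_sqrt (abs_nonneg _) |>.1 hsmall.1
    have him_lt := Real.lt_sqrt (abs_nonneg _) |>.1 hsmall.2
    rw [sq_abs] at hre_lt him_lt
    linarith
  calc _ ≤ _ := measureReal_mono hsub
    _ ≤ _ := measureReal_union_le _ _
    _ ≤ _ := add_le_add hre him
    _ = _ := by ring

end Hoeffding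

section AverageMeasure

variable {M ι : Type*} [MeasurableSpace M] [Fintype ι]

/-- The average of finitely many measures; the average of Dirac masses is the empirical measure. -/
noncomputable def averageMeasure (μ : ι → Measure M) : Measure M :=
  (Fintype.card ι : ENNReal)⁻¹ • ∑ j, μ j

theorem isProbabilityMeasure_averageMeasure [Nonempty ι] (μ : ι → Measure M)
    [∀ j, IsProbabilityMeasure (μ j)] : IsProbabilityMeasure (averageMeasure μ) := by
  constructor
  simp [averageMeasure, ENNReal.inv_mul_cancel]

theorem integral_averageMeasure {E : Type*} [NormedAddCommGroup E] [NormedSpace ℝ E]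
    {μ : ι → Measure M} {g : M → E} (hg : ∀ j, Integrable g (μ j)) :
    ∫ x, g x ∂averageMeasure μ = (Fintype.card ι : ℝ)⁻¹ • ∑ j, ∫ x, g x ∂μ j := by
  rw [averageMeasure, integral_smul_measure, integral_finsetSum_measure fun j _ => hg j]
  simp

theorem integral_averageMeasure_dirac {E : Type*} [NormedAddCommGroup E] [NormedSpace ℝ E]
    [CompleteSpace E] {u : ι → M} {g : M → E} (hg : StronglyMeasurable g) :
    ∫ x, g x ∂averageMeasure (fun j => Measure.dirac (u j)) =
      (Fintype.card ι : ℝ)⁻¹ • ∑ j, g (u j) := by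
  rw [integral_averageMeasure fun j => integrable_dirac' hg (by simp)]
  simp only [integral_dirac' _ _ hg]

end AverageMeasure

section FourierDeviation

variable {Ω ι : Type*} [MeasurableSpace Ω] {P : Measure Ω} [Fintype ι]

/-- The configurations of points on the circle for which some Fourier coefficient of the empirical
measure is far from that of `ν`. The tolerance in the mode `n` grows like `n^(1/4)`: fast enough for
the union bound over the modes to converge, slowly enough to be summable against the Fourier
coefficients of a Lipschitz function. -/
def fourierDeviationSet (ι : Type*) [Fintype ι] (ν : Measure UnitAddCircle) (τ : ℝ) :
    Set (ι → UnitAddCircle) :=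
  ⋃ k : ℕ, {u | 2 * τ ^ 2 * √((k : ℝ) + 1) <
    ‖∫ x, fourier (k + 1 : ℕ) x ∂averageMeasure (fun j => Measure.dirac (u j)) -
      ∫ x, fourier (k + 1 : ℕ) x ∂ν‖ ^ 2}

theorem measurableSet_fourierDeviationSet (ν : Measure UnitAddCircle) (τ : ℝ) :
    MeasurableSet (fourierDeviationSet ι ν τ) := by
  refine MeasurableSet.iUnion fun k => measurableSet_lt measurable_const (Continuous.measurable ?_)
  simp only [integral_averageMeasure_dirac (fourier _).continuous.stronglyMeasurable]
  fun_prop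

theorem abs_integral_averageMeasure_dirac_sub_le [Nonempty ι] {ν : Measure UnitAddCircle}
    [IsProbabilityMeasure ν] {ψ : UnitAddCircle → ℝ} (hψ : ContDiff ℝ 1 fun x : ℝ => ψ x)
    {K : NNReal} (hlip : LipschitzWith K ψ) {τ : ℝ} (hτ : 0 ≤ τ) {u : ι → UnitAddCircle}
    (hu : u ∉ fourierDeviationSet ι ν τ) :
    |∫ x, ψ x ∂averageMeasure (fun j => Measure.dirac (u j)) - ∫ x, ψ x ∂ν| ≤ 0.56 * K * τ := by
  have := isProbabilityMeasure_averageMeasure fun j => Measure.dirac (u j)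
  refine abs_integral_sub_integral_le_of_fourier hψ hlip hτ fun k => not_lt.1 fun hk => hu ?_
  exact Set.mem_iUnion.2 ⟨k, hk⟩

theorem measureReal_fourier_deviation_le [IsProbabilityMeasure P] [Nonempty ι]
    {w : ι → Ω → UnitAddCircle} (hw : ∀ j, Measurable (w j)) (hind : iIndepFun w P) (τ : ℝ)
    (k : ℕ) :
    P.real {ω | 2 * τ ^ 2 * √((k : ℝ) + 1) <
      ‖∫ x, fourier (k + 1 : ℕ) x ∂averageMeasure (fun j => Measure.dirac (w j ω)) -
        ∫ x, fourier (k + 1 : ℕ) x ∂averageMeasure (fun j => P.map (w j))‖ ^ 2} ≤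
      4 * Real.exp (-(Fintype.card ι * τ ^ 2 / 2 * √((k : ℝ) + 1))) := by
  set n : ℝ := (Fintype.card ι : ℝ)
  have hn : 0 < n := by positivity
  set e : C(UnitAddCircle, ℂ) := fourier (k + 1 : ℕ)
  have he (x : UnitAddCircle) : ‖e x‖ ≤ 1 := (Circle.norm_coe _).le
  have hdiff (ω : Ω) : ‖∫ x, e x ∂averageMeasure (fun j => Measure.dirac (w j ω)) -
      ∫ x, e x ∂averageMeasure (fun j => P.map (w j))‖ ^ 2 =
        ‖∑ j, (e (w j ω) - ∫ ω', e (w j ω') ∂P)‖ ^ 2 / n ^ 2 := by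
    have (j : ι) := Measure.isProbabilityMeasure_map (μ := P) (hw j).aemeasurable
    have hmap (j : ι) : ∫ x, e x ∂P.map (w j) = ∫ ω', e (w j ω') ∂P :=
      integral_map (hw j).aemeasurable e.continuous.aestronglyMeasurable
    rw [integral_averageMeasure_dirac e.continuous.stronglyMeasurable, integral_averageMeasure
      fun j => .of_bound e.continuous.aestronglyMeasurable 1 (.of_forall he), ← smul_sub,
      norm_smul, mul_pow, Finset.sum_sub_distrib, div_eq_inv_mul]
    simp [hmap, n]
  have hset : {ω | 2 * τ ^ 2 * √((k : ℝ) + 1) < ‖∑ j, (e (w j ω) - ∫ ω', e (w j ω') ∂P)‖ ^ 2 /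
      n ^ 2} = {ω | 2 * (n ^ 2 * τ ^ 2 * √((k : ℝ) + 1)) <
        ‖∑ j, (e (w j ω) - ∫ ω', e (w j ω') ∂P)‖ ^ 2} := by
    ext ω
    rw [Set.mem_ofPred_eq, Set.mem_ofPred_eq, lt_div_iff₀ (by positivity)]
    ring_nf
  simp only [hdiff, hset]
  refine (measureReal_lt_sq_norm_sum_sub_integral_le
    (fun j => (e.continuous.measurable.comp (hw j)).aemeasurable)
    (hind.comp (fun _ => e) fun _ => e.continuous.measurable) (fun j ω => he _)
    (by positivity)).trans_eq ?_
  congr 3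
  change _ / (2 * n) = _
  field_simp

/-- The constant in the union bound over all Fourier modes. -/
noncomputable def unionBoundConst : ℝ := ∑' k : ℕ, 4 * Real.exp (-((√((k : ℝ) + 1) - 1) / 2))

theorem summable_unionBoundConst :
    Summable fun k : ℕ => 4 * Real.exp (-((√((k : ℝ) + 1) - 1) / 2)) := by
  have hsq : Summable fun k : ℕ => 4 * Real.exp (1 / 2) * 384 * (1 / ((k : ℝ) + 1) ^ 2) := by
    have := (summable_nat_add_iff 1).2 (Real.summable_one_div_nat_pow.2 one_lt_two)
    exact (by simpa using this : Summable fun k : ℕ => 1 / ((k : ℝ) + 1) ^ 2).mul_left _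
  refine .of_nonneg_of_le (fun k => by positivity) (fun k => ?_) hsq
  set s := √((k : ℝ) + 1)
  have hs0 : 0 < s := Real.sqrt_pos.2 (by positivity)
  have hk : ((k : ℝ) + 1) ^ 2 = s ^ 4 := by
    rw [show s ^ 4 = (s ^ 2) ^ 2 by ring, Real.sq_sqrt (by positivity)]
  have hpow : s ^ 4 / 384 ≤ Real.exp (s / 2) := by
    have := Real.pow_div_factorial_le_exp (s / 2) (by positivity) 4
    norm_num [Nat.factorial, div_pow, div_div] at this
    exact this
  calc 4 * Real.exp (-((s - 1) / 2)) = 4 * Real.exp (1 / 2) * (Real.exp (s / 2))⁻¹ := by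
        rw [mul_assoc, ← Real.exp_neg, ← Real.exp_add]
        ring_nf
    _ ≤ 4 * Real.exp (1 / 2) * (s ^ 4 / 384)⁻¹ := by gcongr
    _ = 4 * Real.exp (1 / 2) * 384 * (1 / ((k : ℝ) + 1) ^ 2) := by
        rw [hk]
        field_simp

theorem unionBoundConst_nonneg : 0 ≤ unionBoundConst :=
  tsum_nonneg fun _ => by positivity

theorem measureReal_iUnion_le_tsum {κ : Type*} [Countable κ] [IsFiniteMeasure P] {s : κ → Set Ω}
    {a : κ → ℝ} (ha : Summable a) (hs : ∀ k, P.real (s k) ≤ a k) :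
    P.real (⋃ k, s k) ≤ ∑' k, a k := by
  have ha0 (k : κ) : 0 ≤ a k := measureReal_nonneg.trans (hs k)
  refine ENNReal.toReal_le_of_le_ofReal (tsum_nonneg ha0) ?_
  rw [ENNReal.ofReal_tsum_of_nonneg ha0 ha]
  exact (measure_iUnion_le s).trans (ENNReal.tsum_le_tsum fun k =>
    (ENNReal.le_ofReal_iff_toReal_le (measure_ne_top _ _) (ha0 k)).2 (hs k))

theorem measureReal_fourierDeviationSet_le [IsProbabilityMeasure P] [Nonempty ι]
    {w : ι → Ω → UnitAddCircle} (hw : ∀ j, Measurable (w j)) (hind : iIndepFun w P) {τ : ℝ}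
    (hτ : 1 / 2 ≤ Fintype.card ι * τ ^ 2 / 2) :
    P.real {ω | (fun j => w j ω) ∈ fourierDeviationSet ι (averageMeasure fun j => P.map (w j)) τ} ≤
      unionBoundConst * Real.exp (-(Fintype.card ι * τ ^ 2 / 2)) := by
  simp only [fourierDeviationSet, Set.mem_iUnion, Set.mem_ofPred_eq, Set.ofPred_exists]
  rw [unionBoundConst, ← tsum_mul_right]
  refine measureReal_iUnion_le_tsum (summable_unionBoundConst.mul_right _) fun k =>
    (measureReal_fourier_deviation_le hw hind τ k).trans ?_
  have hone : 1 ≤ √((k : ℝ) + 1) := Real.one_le_sqrt.2 (by simp)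
  rw [mul_assoc, ← Real.exp_add]
  gcongr
  nlinarith [mul_nonneg (sub_nonneg.2 hτ) (sub_nonneg.2 hone)]

end FourierDeviation

/-! ### A strong law of large numbers for finitely dependent sequences -/

theorem sum_range_eq_sum_sum_residues {M : Type*} [AddCommMonoid M] (f : ℕ → M) {n : ℕ}
    (hn : 0 < n) (T : ℕ) :
    ∑ s ∈ Finset.range T, f s =
      ∑ r ∈ Finset.range n, ∑ i ∈ Finset.range ((T + (n - 1 - r)) / n), f (r + n * i) := by
  induction T with
  | zero =>
    refine (Finset.sum_eq_zero fun r _ => ?_).symm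
    rw [Nat.div_eq_of_lt (by omega), Finset.sum_range_zero]
  | succ T ih =>
    have hT : n * (T / n) + T % n = T := Nat.div_add_mod T n
    have hTn : T % n < n := Nat.mod_lt T hn
    have hstep : ∀ r ∈ Finset.range n,
        ∑ i ∈ Finset.range ((T + 1 + (n - 1 - r)) / n), f (r + n * i) =
          ∑ i ∈ Finset.range ((T + (n - 1 - r)) / n), f (r + n * i) +
            if r = T % n then f T else 0 := by
      intro r hr
      rw [Finset.mem_range] at hr
      have hdvd : n ∣ T + (n - 1 - r) + 1 ↔ r = T % n := by
        rw [show T + (n - 1 - r) + 1 = n * (T / n) + (T % n + (n - r)) by omega,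
          Nat.dvd_add_right (Nat.dvd_mul_right n _)]
        refine ⟨fun h => ?_, fun h => ⟨1, by omega⟩⟩
        have := Nat.eq_of_dvd_of_lt_two_mul (by omega) h (by omega)
        omega
      rw [Nat.add_right_comm, Nat.succ_div]
      split_ifs with hdiv hrT hrT
      · have hquot : (T + (n - 1 - r)) / n = T / n := by
          rw [show T + (n - 1 - r) = n - 1 + n * (T / n) by omega, Nat.add_mul_div_left _ _ hn,
            Nat.div_eq_of_lt (by omega), zero_add]
        rw [Finset.sum_range_succ, hquot, show r + n * (T / n) = T by omega]
      · exact absurd (hdvd.1 hdiv) hrT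
      · exact absurd (hdvd.2 hrT) hdiv
      · rw [add_zero, add_zero]
    rw [Finset.sum_range_succ, ih, Finset.sum_congr rfl hstep, Finset.sum_add_distrib,
      Finset.sum_ite_eq' _ _ _, if_pos (Finset.mem_range.2 (Nat.mod_lt T hn))]

theorem tendsto_add_div_div_natCast {n : ℕ} (hn : 0 < n) (a : ℕ) :
    Tendsto (fun T : ℕ => (((T + a) / n : ℕ) : ℝ) / T) atTop (nhds (1 / n)) := by
  have hshift : Tendsto (fun T : ℕ => (T : ℝ) + a) atTop atTop :=
    tendsto_atTop_add_const_right _ _ tendsto_natCast_atTop_atTop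
  have hfloor := (tendsto_nat_floor_mul_div_atTop (by positivity : (0 : ℝ) ≤ 1 / n)).comp hshift
  have hratio : Tendsto (fun T : ℕ => ((T : ℝ) + a) / T) atTop (nhds 1) := by
    simpa using (tendsto_natCast_div_add_atTop (a : ℝ)).inv₀ one_ne_zero
  rw [← mul_one (1 / (n : ℝ))]
  refine (hfloor.mul hratio).congr' ?_
  filter_upwards [eventually_gt_atTop 0] with T hT
  have hcast : 1 / (n : ℝ) * (T + a) = ((T + a : ℕ) : ℝ) / n := by push_cast; ring
  simp only [Function.comp_apply, hcast, Nat.floor_div_eq_div]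
  have : (T : ℝ) + a ≠ 0 := by positivity
  field_simp

theorem tendsto_sum_range_div_of_residues {f : ℕ → ℝ} {n : ℕ} (hn : 0 < n) {c : ℝ}
    (hf : ∀ r, Tendsto (fun m : ℕ => (∑ i ∈ Finset.range m, f (r + n * i)) / m) atTop (nhds c)) :
    Tendsto (fun T : ℕ => (∑ s ∈ Finset.range T, f s) / T) atTop (nhds c) := by
  have hcount (a : ℕ) : Tendsto (fun T : ℕ => (T + a) / n) atTop atTop :=
    (Nat.tendsto_div_const_atTop hn.ne').comp (tendsto_add_atTop_nat a)
  have hres (r : ℕ) : Tendsto (fun T : ℕ =>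
      (∑ i ∈ Finset.range ((T + (n - 1 - r)) / n), f (r + n * i)) / T) atTop
        (nhds (c * (1 / n))) := by
    refine (((hf r).comp (hcount (n - 1 - r))).mul
      (tendsto_add_div_div_natCast hn (n - 1 - r))).congr' ?_
    filter_upwards [(hcount (n - 1 - r)).eventually_gt_atTop 0] with T hT
    have : (((T + (n - 1 - r)) / n : ℕ) : ℝ) ≠ 0 := by exact_mod_cast hT.ne'
    simp only [Function.comp_apply]
    field_simp
  have hn' : (n : ℝ) ≠ 0 := by exact_mod_cast hn.ne'
  have hsum := tendsto_finsetSum (Finset.range n) fun r _ => hres r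
  simp only [Finset.sum_const, Finset.card_range, nsmul_eq_mul, ← Finset.sum_div,
    ← sum_range_eq_sum_sum_residues f hn] at hsum
  rwa [show (n : ℝ) * (c * (1 / n)) = c by field_simp] at hsum

theorem ae_tendsto_average_of_indepFun_of_add_le {Ω : Type*} [MeasurableSpace Ω] {P : Measure Ω}
    {X : ℕ → Ω → ℝ} {n : ℕ} (hn : 0 < n) (hint : Integrable (X 0) P)
    (hindep : ∀ s t, s + n ≤ t → IndepFun (X s) (X t) P)
    (hident : ∀ s, IdentDistrib (X s) (X 0) P P) :
    ∀ᵐ ω ∂P, Tendsto (fun T : ℕ => (∑ s ∈ Finset.range T, X s ω) / T) atTop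
      (nhds (∫ ω, X 0 ω ∂P)) := by
  have hgap {r i j : ℕ} (hij : i < j) : r + n * i + n ≤ r + n * j := by
    have := Nat.mul_le_mul_left n (Nat.succ_le_of_lt hij)
    rw [Nat.mul_succ] at this
    omega
  have hresidue (r : ℕ) := strong_law_ae_real (μ := P) (fun i => X (r + n * i))
    ((hident _).integrable_iff.2 hint)
    (fun i j hij => hij.lt_or_gt.elim (fun hlt => hindep _ _ (hgap hlt))
      fun hgt => (hindep _ _ (hgap hgt)).symm)
    fun i => (hident _).trans (hident _).symm
  filter_upwards [ae_all_iff.2 hresidue] with ω hω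
  exact tendsto_sum_range_div_of_residues (f := fun s => X s ω) hn fun r =>
    (hident (r + n * 0)).integral_eq ▸ hω r

theorem ae_tendsto_birkhoffAverage_of_measurable_nodeSigma {Ω ι : Type*} [MeasurableSpace Ω]
    {P : Measure Ω} {θ : Ω → Ω} {φ : ι → ℕ → Ω → UnitAddCircle → UnitAddCircle}
    (hθ : MeasurePreserving θ P P) (hrds : ∀ i, IsRDS θ (φ i)) (hnodes : IIDNodeMaps P θ φ)
    {n : ℕ} (hn : 0 < n) {u : Ω → ℝ}
    (hu : ∀ s, Measurable[nodeSigma θ φ {q | s ≤ q.1 ∧ q.1 < s + n}] fun ω => u (θ^[s] ω))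
    (hint : Integrable u P) :
    ∀ᵐ ω ∂P, Tendsto (fun T => birkhoffAverage ℝ θ u T ω) atTop (nhds (∫ ω, u ω ∂P)) := by
  have hmeas : Measurable u := (hu 0).mono (nodeSigma_le hθ.measurable hrds _) le_rfl
  have hindep (s t : ℕ) (hst : s + n ≤ t) :
      IndepFun (fun ω => u (θ^[s] ω)) (fun ω => u (θ^[t] ω)) P := by
    have hdisj : Disjoint {q : ℕ × ι | s ≤ q.1 ∧ q.1 < s + n} {q | t ≤ q.1 ∧ q.1 < t + n} :=
      Set.disjoint_left.2 fun q hs ht => absurd (hst.trans ht.1) hs.2.not_ge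
    rw [IndepFun_iff_Indep]
    exact indep_of_indep_of_le_left (indep_of_indep_of_le_right
      (hnodes.indep_nodeSigma hθ.measurable hrds hdisj) (hu t).comap_le) (hu s).comap_le
  have hident (s : ℕ) : IdentDistrib (fun ω => u (θ^[s] ω)) u P P :=
    ⟨(hmeas.comp (hθ.iterate s).measurable).aemeasurable, hmeas.aemeasurable,
      by conv_rhs => rw [← (hθ.iterate s).map_eq, Measure.map_map hmeas (hθ.iterate s).measurable]
         rfl⟩
  filter_upwards [ae_tendsto_average_of_indepFun_of_add_le hn hint hindep hident] with ω hω
  simpa only [birkhoffAverage, birkhoffSum, smul_eq_mul, div_eq_inv_mul,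
    Function.iterate_zero, id_eq] using hω

/-! ### The star network -/

section Network

open scoped NNReal

variable {Ω : Type*} {L : ℕ} {θ : Ω → Ω} {φ : Fin (L + 1) → ℕ → Ω → UnitAddCircle → UnitAddCircle}
  {h : Ω → UnitAddCircle → UnitAddCircle → ℝ} {α A : ℝ} {K : ℝ≥0}

theorem dist_starStep_succ_le (hα : 0 ≤ α) {ω : Ω} {j : Fin L} (hK : LipschitzWith K (φ j.succ 1 ω))
    (hA : ∀ p q, |h ω p q| ≤ A) (x : Fin (L + 1) → UnitAddCircle) (q : UnitAddCircle) :
    dist (starStep φ h α ω x j.succ) (φ j.succ 1 ω q) ≤ α * A / L + K * dist (x j.succ) q := by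
  have hcoupling : |α * (1 / (L : ℝ) * h ω (x j.succ) (x 0))| ≤ α * A / L := by
    rw [abs_mul, abs_mul, abs_of_nonneg hα, abs_of_nonneg (by positivity : 0 ≤ 1 / (L : ℝ)),
      mul_div_assoc, one_div_mul_eq_div]
    have := hA (x j.succ) (x 0)
    gcongr
  refine (dist_triangle _ (φ j.succ 1 ω (x j.succ)) _).trans (add_le_add ?_ (hK.dist_le_mul _ _))
  rw [starStep, Fin.cons_succ, dist_eq_norm, add_sub_cancel_left]
  refine le_trans ?_ hcoupling
  simpa [UnitAddCircle.norm_eq] using round_le (α * (1 / (L : ℝ) * h ω (x j.succ) (x 0))) 0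

theorem dist_starOrbit_flow_le [MeasurableSpace Ω] (hα : 0 ≤ α) (hK1 : K < 1)
    (hrds : ∀ i, IsRDS θ (φ i)) (hK : ∀ i ω, LipschitzWith K (φ i 1 ω)) {ω : Ω}
    (hA : ∀ t p q, |h (θ^[t] ω) p q| ≤ A) (x : Fin (L + 1) → UnitAddCircle) (q : UnitAddCircle)
    (s n : ℕ) (j : Fin L) :
    dist (starOrbit θ φ h α (s + n) ω x j.succ) (φ j.succ n (θ^[s] ω) q) ≤
      α * A / (L * (1 - K)) + K ^ n / 2 := by
  have hL : (0 : ℝ) < L := by exact_mod_cast j.pos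
  have hgap : (0 : ℝ) < 1 - K := sub_pos.2 hK1
  induction n with
  | zero =>
    have hA0 : 0 ≤ A := (abs_nonneg _).trans (hA 0 0 0)
    have : 0 ≤ α * A / (L * (1 - K)) := by positivity
    linarith [dist_unitAddCircle_le_half (starOrbit θ φ h α (s + 0) ω x j.succ)
      (φ j.succ 0 (θ^[s] ω) q)]
  | succ n ih =>
    rw [(hrds _).succ, ← Function.iterate_add_apply, add_comm n s]
    calc dist (starOrbit θ φ h α (s + n + 1) ω x j.succ)
          (φ j.succ 1 (θ^[s + n] ω) (φ j.succ n (θ^[s] ω) q))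
        ≤ α * A / L + K * (α * A / (L * (1 - K)) + K ^ n / 2) :=
          (dist_starStep_succ_le hα (hK _ _) (hA _) _ _).trans (by gcongr)
      _ = α * A / (L * (1 - K)) + K ^ (n + 1) / 2 := by
          field_simp
          ring

theorem admitsReduction_of_forall_mem {m : Measure UnitAddCircle} {ε p : ℝ} {ω : Ω}
    {x : Fin (L + 1) → UnitAddCircle} {E : Set Ω} {n : ℕ}
    (hE : ∀ s, ¬ AdmitsReductionAt θ φ h α m ε ω x (s + n) → θ^[s] ω ∈ E)
    (hfreq : Tendsto (fun T => birkhoffAverage ℝ θ (E.indicator 1) T ω) atTop (nhds p)) :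
    AdmitsReduction θ φ h α m ε p ω x := by
  classical
  have hcount (T : ℕ) :
      (((Finset.range T).filter fun t => ¬ AdmitsReductionAt θ φ h α m ε ω x t).card : ℝ) ≤
        n + birkhoffSum θ (E.indicator 1) T ω := by
    have hsub : (Finset.range T).filter (fun t => ¬ AdmitsReductionAt θ φ h α m ε ω x t) ⊆
        Finset.range n ∪ ((Finset.range T).filter fun s => θ^[s] ω ∈ E).image (· + n) := by
      intro t ht
      rw [Finset.mem_filter, Finset.mem_range] at ht
      rw [Finset.mem_union, Finset.mem_range, Finset.mem_image]
      refine (lt_or_ge t n).imp_right fun htn => ?_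
      obtain ⟨s, rfl⟩ := Nat.exists_eq_add_of_le' htn
      exact ⟨s, Finset.mem_filter.2 ⟨Finset.mem_range.2 (by omega), hE s ht.2⟩, rfl⟩
    have hcard := (Finset.card_le_card hsub).trans
      ((Finset.card_union_le _ _).trans (Nat.add_le_add_left Finset.card_image_le _))
    rw [Finset.card_range] at hcard
    simp only [birkhoffSum, Set.indicator_apply, Pi.one_apply, Finset.sum_boole]
    exact_mod_cast hcard
  have hlim : Tendsto (fun T : ℕ => (n : ℝ) / T + birkhoffAverage ℝ θ (E.indicator 1) T ω) atTop
      (nhds p) := by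
    simpa using (tendsto_const_div_atTop_nhds_zero_nat (n : ℝ)).add hfreq
  refine (limsup_le_limsup (Eventually.of_forall fun T => ?_)
    (isCoboundedUnder_le_of_le atTop (x := 0) fun T => by positivity)
    hlim.isBoundedUnder_le).trans_eq hlim.limsup_eq
  rw [birkhoffAverage, smul_eq_mul, inv_mul_eq_div, ← add_div]
  convert div_le_div_of_nonneg_right (hcount T) T.cast_nonneg

theorem AdmitsReduction.mono {m : Measure UnitAddCircle} {ε p q : ℝ} {ω : Ω}
    {x : Fin (L + 1) → UnitAddCircle} (hp : AdmitsReduction θ φ h α m ε p ω x) (hpq : p ≤ q) :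
    AdmitsReduction θ φ h α m ε q ω x :=
  le_trans hp hpq

theorem fluctuation_eq (x : Fin (L + 1) → UnitAddCircle) (m : Measure UnitAddCircle) {ω : Ω}
    (hcont : Continuous (h ω (x 0))) :
    fluctuation h α m ω x =
      α * (∫ y, h ω (x 0) y ∂averageMeasure (fun j : Fin L => Measure.dirac (x j.succ)) -
        ∫ y, h ω (x 0) y ∂m) := by
  rw [integral_averageMeasure_dirac hcont.stronglyMeasurable, fluctuation, Fintype.card_fin,
    one_div, smul_eq_mul]

end Network

/-! ### Deviation events -/

section Deviation

open scoped NNReal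

theorem dist_integral_averageMeasure_le {M ι : Type*} [MeasurableSpace M] [Fintype ι] [Nonempty ι]
    {μ ν : ι → Measure M} {g : M → ℝ} (hμ : ∀ j, Integrable g (μ j)) (hν : ∀ j, Integrable g (ν j))
    {c : ℝ} (hc : ∀ j, dist (∫ x, g x ∂μ j) (∫ x, g x ∂ν j) ≤ c) :
    dist (∫ x, g x ∂averageMeasure μ) (∫ x, g x ∂averageMeasure ν) ≤ c := by
  rw [integral_averageMeasure hμ, integral_averageMeasure hν, dist_smul₀, Real.norm_eq_abs,
    abs_of_nonneg (by positivity), inv_mul_le_iff₀ (by positivity), ← nsmul_eq_mul]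
  exact (dist_sum_sum_le_of_le Finset.univ fun j _ => hc j).trans_eq (by simp)

theorem averageMeasure_const {M ι : Type*} [MeasurableSpace M] [Fintype ι] [Nonempty ι]
    (m : Measure M) : averageMeasure (fun _ : ι => m) = m := by
  ext s _
  simp [averageMeasure, ← mul_assoc, ENNReal.inv_mul_cancel]

variable {Ω : Type*} [MeasurableSpace Ω] {P : Measure Ω} [IsProbabilityMeasure P] {L : ℕ}
  {θ : Ω → Ω} {φ : Fin (L + 1) → ℕ → Ω → UnitAddCircle → UnitAddCircle}
  {h : Ω → UnitAddCircle → UnitAddCircle → ℝ} {α A : ℝ} {K : ℝ≥0}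

/-- The law of the low-degree nodes after `n` uncoupled steps from `0`, averaged over the nodes. -/
noncomputable def nodeLaw (P : Measure Ω) (φ : Fin (L + 1) → ℕ → Ω → UnitAddCircle → UnitAddCircle)
    (n : ℕ) : Measure UnitAddCircle :=
  averageMeasure fun j : Fin L => P.map fun ω => φ j.succ n ω 0

/-- The event that the uncoupled low-degree nodes, started from `0`, deviate from their law after
`n` steps. -/
def deviationEvent (P : Measure Ω) (φ : Fin (L + 1) → ℕ → Ω → UnitAddCircle → UnitAddCircle)
    (n : ℕ) (τ : ℝ) : Set Ω :=
  {ω | (fun j : Fin L => φ j.succ n ω 0) ∈ fourierDeviationSet (Fin L) (nodeLaw P φ n) τ}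

theorem measureReal_deviationEvent_le (hL : 0 < L) (hθ : Measurable θ)
    (hrds : ∀ i, IsRDS θ (φ i)) (hcont : ∀ i ω, Continuous (φ i 1 ω))
    (hnodes : IIDNodeMaps P θ φ) (n : ℕ) {τ : ℝ} (hτ : 1 / 2 ≤ L * τ ^ 2 / 2) :
    P.real (deviationEvent P φ n τ) ≤ unionBoundConst * Real.exp (-(L * τ ^ 2 / 2)) := by
  have := Fin.pos_iff_nonempty.1 hL
  have hind : iIndepFun (fun i ω => φ i n ω 0) P :=
    iIndepFun_of_measurable_nodeSigma hθ hrds hnodes fun i =>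
      measurable_nodeSigma_flow (s := 0) hrds hcont (fun _ _ => rfl) 0
  have := measureReal_fourierDeviationSet_le (fun j : Fin L => (hrds j.succ).measurable_apply n 0)
    (hind.precomp (Fin.succ_injective L)) (τ := τ) (by rwa [Fintype.card_fin])
  rwa [Fintype.card_fin] at this

theorem ae_tendsto_birkhoffAverage_deviationEvent (hθ : MeasurePreserving θ P P)
    (hrds : ∀ i, IsRDS θ (φ i)) (hcont : ∀ i ω, Continuous (φ i 1 ω))
    (hnodes : IIDNodeMaps P θ φ) {n : ℕ} (hn : 0 < n) (τ : ℝ) :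
    ∀ᵐ ω ∂P, Tendsto
      (fun T => birkhoffAverage ℝ θ ((deviationEvent P φ n τ).indicator 1) T ω) atTop
      (nhds (P.real (deviationEvent P φ n τ))) := by
  have hmeas (s : ℕ) : MeasurableSet[nodeSigma θ φ {q | s ≤ q.1 ∧ q.1 < s + n}]
      {ω | θ^[s] ω ∈ deviationEvent P φ n τ} := by
    have hflow (j : Fin L) : Measurable[nodeSigma θ φ {q | s ≤ q.1 ∧ q.1 < s + n}]
        fun ω => φ j.succ n (θ^[s] ω) 0 :=
      measurable_nodeSigma_flow hrds hcont
        (fun k hk => And.intro (Nat.le_add_right s k) (Nat.add_lt_add_left hk s)) 0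
    exact (@measurable_pi_lambda _ _ _ (nodeSigma θ φ {q | s ≤ q.1 ∧ q.1 < s + n}) _ _ hflow)
      (measurableSet_fourierDeviationSet (nodeLaw P φ n) τ)
  have hE : MeasurableSet (deviationEvent P φ n τ) := nodeSigma_le hθ.measurable hrds _ _ (hmeas 0)
  rw [← integral_indicator_one hE]
  exact ae_tendsto_birkhoffAverage_of_measurable_nodeSigma hθ hrds hnodes hn
    (fun s => Measurable.indicator measurable_const (hmeas s))
    ((integrable_const 1).indicator hE)

theorem dist_integral_nodeLaw_le (hL : 0 < L) (hθ : MeasurePreserving θ P P)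
    (hrds : ∀ i, IsRDS θ (φ i)) (hK : ∀ i ω, LipschitzWith K (φ i 1 ω))
    (hnodes : IIDNodeMaps P θ φ) {m : Measure UnitAddCircle}
    (hm : ∀ i, IsStationaryMeasure P (φ i) m) {ψ : UnitAddCircle → ℝ} {B : ℝ≥0}
    (hψ : LipschitzWith B ψ) (n : ℕ) :
    dist (∫ y, ψ y ∂nodeLaw P φ n) (∫ y, ψ y ∂m) ≤ B * K ^ n * (1 / 2) := by
  have := Fin.pos_iff_nonempty.1 hL
  have := (hm 0).isProb
  have hprob (j : Fin L) := Measure.isProbabilityMeasure_map (μ := P)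
    ((hrds j.succ).measurable_apply n 0).aemeasurable
  have hint (μ : Measure UnitAddCircle) [IsProbabilityMeasure μ] : Integrable ψ μ :=
    integrable_comp_of_lipschitzWith dist_unitAddCircle_le_half hψ measurable_id
  rw [← averageMeasure_const (ι := Fin L) m, nodeLaw]
  exact dist_integral_averageMeasure_le (fun j => hint _) (fun _ => hint m) fun j =>
    dist_integral_map_flow_le hθ hrds hK hnodes (hm _) hψ n 0

theorem abs_fluctuation_le_of_notMem_deviationEvent (hL : 0 < L) (hα : 0 ≤ α)
    (hθ : MeasurePreserving θ P P) (hrds : ∀ i, IsRDS θ (φ i)) (hK1 : K < 1)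
    (hK : ∀ i ω, LipschitzWith K (φ i 1 ω)) (hnodes : IIDNodeMaps P θ φ)
    {m : Measure UnitAddCircle} (hm : ∀ i, IsStationaryMeasure P (φ i) m)
    (hsmooth : ∀ ω, IsC4 (h ω)) {ω : Ω} (hA : ∀ t p q, |h (θ^[t] ω) p q| ≤ A) {B : ℝ≥0}
    (hB : ∀ t, LipschitzWith B (Function.uncurry (h (θ^[t] ω)))) {n s : ℕ} {τ : ℝ} (hτ : 0 ≤ τ)
    (hω : θ^[s] ω ∉ deviationEvent P φ n τ) (x : Fin (L + 1) → UnitAddCircle) :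
    |fluctuation h α m (θ^[s + n] ω) (starOrbit θ φ h α (s + n) ω x)| ≤
      α * (B * (α * A / (L * (1 - K)) + K ^ n + 0.56 * τ)) := by
  have := Fin.pos_iff_nonempty.1 hL
  have hprob (j : Fin L) := Measure.isProbabilityMeasure_map (μ := P)
    ((hrds j.succ).measurable_apply n 0).aemeasurable
  have : IsProbabilityMeasure (nodeLaw P φ n) := isProbabilityMeasure_averageMeasure _
  set y := starOrbit θ φ h α (s + n) ω x
  set ψ : UnitAddCircle → ℝ := h (θ^[s + n] ω) (y 0)
  set w : Fin L → UnitAddCircle := fun j => φ j.succ n (θ^[s] ω) 0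
  have hψ : LipschitzWith B ψ := by
    have := (hB (s + n)).comp (LipschitzWith.prodMk_left (y 0))
    rwa [mul_one] at this
  have hsmoothψ : ContDiff ℝ 1 fun r : ℝ => ψ r :=
    ((hsmooth _).contDiff_right (y 0)).of_le (by norm_num)
  have hdirac (u : UnitAddCircle) : Integrable ψ (Measure.dirac u) :=
    integrable_comp_of_lipschitzWith dist_unitAddCircle_le_half hψ measurable_id
  have hshadow : dist (∫ p, ψ p ∂averageMeasure fun j : Fin L => Measure.dirac (y j.succ))
      (∫ p, ψ p ∂averageMeasure fun j => Measure.dirac (w j)) ≤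
        B * (α * A / (L * (1 - K)) + K ^ n / 2) := by
    refine dist_integral_averageMeasure_le (fun j => hdirac _) (fun j => hdirac _) fun j => ?_
    simp only [integral_dirac]
    exact (hψ.dist_le_mul _ _).trans (by
      gcongr; exact dist_starOrbit_flow_le hα hK1 hrds hK hA x 0 s n j)
  have hconc := abs_integral_averageMeasure_dirac_sub_le hsmoothψ hψ hτ hω
  have hlaw := dist_integral_nodeLaw_le hL hθ hrds hK hnodes hm hψ n
  rw [fluctuation_eq y m hψ.continuous, abs_mul, abs_of_nonneg hα]
  refine mul_le_mul_of_nonneg_left ?_ hα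
  rw [← Real.dist_eq] at hconc ⊢
  have := dist_triangle4 _ _ _ _ |>.trans (add_le_add_three hshadow hconc hlaw)
  linarith

end Deviation

/-! ### The exceptional frequency -/

/-- The absolute constant in front of the exceptional frequency. -/
noncomputable def reductionConst : ℝ := 4 + 160 * unionBoundConst

theorem reductionConst_pos : 0 < reductionConst := by
  have := unionBoundConst_nonneg
  unfold reductionConst
  positivity

/-- The exceptional frequency `ρ(ε, ω)` for `H = sup_t ‖h (θ^t ω)‖_{C⁴}`. -/
noncomputable def exceptionalFrequency (L α ε H : ℝ) : ℝ :=
  reductionConst * ε⁻¹ * H * Real.exp (-(L * ε ^ 2 * α⁻¹ ^ 2 * (450 / H ^ 2)))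

theorem exceptionalFrequency_nonneg (L α : ℝ) {ε H : ℝ} (hε : 0 ≤ ε) (hH : 0 ≤ H) :
    0 ≤ exceptionalFrequency L α ε H := by
  have := reductionConst_pos
  unfold exceptionalFrequency
  positivity

section TailBound

variable {B H L α ε w : ℝ}

theorem one_le_div_mul_exp_neg (hB : 0 < B) (hw : 0 < w) (hw1 : w ≤ 1) (hwB : 1 ≤ w * B ^ 2) :
    1 ≤ 2 * (B / w) * Real.exp (-(0.44 * w)) := by
  have hB1 : 1 ≤ B := by
    have : 1 ≤ B ^ 2 := hwB.trans (mul_le_of_le_one_left (sq_nonneg B) hw1)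
    exact (one_le_sq_iff₀ hB.le).1 this
  have hratio : 1 ≤ B / w := (one_le_div hw).2 (hw1.trans hB1)
  have hexp : 0.56 ≤ Real.exp (-(0.44 * w)) := by
    linarith [Real.add_one_le_exp (-(0.44 * w))]
  calc (1 : ℝ) ≤ 2 * 1 * 0.56 := by norm_num
    _ ≤ 2 * (B / w) * Real.exp (-(0.44 * w)) := by gcongr

theorem exp_neg_le_div_mul_exp_neg {r : ℝ} (hB : 0 < B) (hw : 1 ≤ w) (hwB : 1 ≤ w * B ^ 2)
    (hr : 0.605 * w ≤ r) : Real.exp (-r) ≤ 80 * (B / w) * Real.exp (-(0.44 * w)) := by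
  have hw0 : 0 < w := by linarith
  have hBw : 1 ≤ B * w := by
    have : 1 ≤ (B * w) ^ 2 := hwB.trans (by nlinarith [sq_nonneg B])
    exact (one_le_sq_iff₀ (by positivity)).1 this
  have hdecay : Real.exp (-(0.16 * w)) ≤ 80 / w ^ 2 := by
    have hsq : w ^ 2 / 80 ≤ Real.exp (0.16 * w) := by
      have := Real.pow_div_factorial_le_exp (0.16 * w) (by positivity) 2
      norm_num [Nat.factorial] at this ⊢
      nlinarith [sq_nonneg w]
    rw [Real.exp_neg, ← inv_div]
    gcongr
  calc Real.exp (-r) ≤ Real.exp (-(0.16 * w)) * Real.exp (-(0.44 * w)) := by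
        rw [← Real.exp_add, Real.exp_le_exp]
        linarith
    _ ≤ 80 / w ^ 2 * Real.exp (-(0.44 * w)) := by gcongr
    _ ≤ 80 * (B / w) * Real.exp (-(0.44 * w)) := by
        gcongr
        rw [mul_div_assoc', div_le_div_iff₀ (by positivity) hw0]
        nlinarith

theorem le_div_mul_exp_neg_of_tail_bound {c p r : ℝ} (hc : 0 ≤ c) (hB : 0 < B) (hw : 0 < w)
    (hwB : 1 ≤ w * B ^ 2) (hr : 0.605 * w ≤ r) (hp1 : p ≤ 1)
    (hp : 1 / 2 ≤ r → p ≤ c * Real.exp (-r)) :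
    p ≤ (2 + 80 * c) * (B / w) * Real.exp (-(0.44 * w)) := by
  have hprod : 0 ≤ B / w * Real.exp (-(0.44 * w)) := by positivity
  rcases le_total w 1 with hw1 | hw1
  · have := hp1.trans (one_le_div_mul_exp_neg hB hw hw1 hwB)
    linarith [mul_nonneg hc hprod]
  · have := mul_le_mul_of_nonneg_left (exp_neg_le_div_mul_exp_neg hB hw1 hwB hr) hc
    linarith [hp (by linarith)]

theorem rate_mul_le_of_lip_le (hw : 0 ≤ w) (hB : 0 < B) (hBH : B ≤ H / 32) :
    w * B ^ 2 * (450 / H ^ 2) ≤ 0.44 * w := by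
  have hH : 0 < H := by linarith
  have hratio : B ^ 2 * (450 / H ^ 2) ≤ 0.44 := by
    have := pow_le_pow_left₀ hB.le hBH 2
    rw [mul_div_assoc', div_le_iff₀ (by positivity)]
    linarith [sq_nonneg H]
  nlinarith

theorem div_rate_le_inv_mul {A : ℝ} (hL : 0 < L) (hα : 0 < α) (hε : 0 < ε) (hB : 0 < B)
    (hH : 0 ≤ H) (hBA : B ^ 2 ≤ 8 * A * H) (hεAB : 4 * α ^ 2 * A * B ≤ ε * L) :
    B / (L * ε ^ 2 / (α ^ 2 * B ^ 2)) ≤ 2 * (ε⁻¹ * H) := by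
  have hcube : α ^ 2 * B ^ 3 ≤ 2 * (ε * L * H) :=
    calc α ^ 2 * B ^ 3 = α ^ 2 * B * B ^ 2 := by ring
      _ ≤ α ^ 2 * B * (8 * A * H) := by gcongr
      _ = 2 * (4 * α ^ 2 * A * B * H) := by ring
      _ ≤ 2 * (ε * L * H) := by gcongr
  calc B / (L * ε ^ 2 / (α ^ 2 * B ^ 2)) = α ^ 2 * B ^ 3 / (L * ε ^ 2) := by field_simp
    _ ≤ 2 * (ε * L * H) / (L * ε ^ 2) := by gcongr
    _ = 2 * (ε⁻¹ * H) := by field_simp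

theorem le_exceptionalFrequency_of_tail_bound {A τ p : ℝ} (hL : 0 < L) (hα : 0 < α) (hε : 0 < ε)
    (hB : 0 < B) (hBH : B ≤ H / 32) (hBA : B ^ 2 ≤ 8 * A * H) (hαε : α ^ 2 ≤ L * ε ^ 2)
    (hεAB : 4 * α ^ 2 * A * B ≤ ε * L) (hτ : 1.1 * (ε / α / B) ≤ τ) (hp1 : p ≤ 1)
    (hp : 1 / 2 ≤ L * τ ^ 2 / 2 → p ≤ unionBoundConst * Real.exp (-(L * τ ^ 2 / 2))) :
    p ≤ exceptionalFrequency L α ε H := by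
  have hconst := unionBoundConst_nonneg
  have hH : 0 ≤ H := by linarith
  set w := L * ε ^ 2 / (α ^ 2 * B ^ 2) with hw
  have hw0 : 0 < w := by positivity
  have hwB : w * B ^ 2 = L * ε ^ 2 * α⁻¹ ^ 2 := by
    rw [hw]
    field_simp
  have hwB1 : 1 ≤ w * B ^ 2 := by
    rwa [hwB, inv_pow, ← div_eq_mul_inv, one_le_div (by positivity)]
  have hr : 0.605 * w ≤ L * τ ^ 2 / 2 :=
    calc 0.605 * w = L * (1.1 * (ε / α / B)) ^ 2 / 2 := by
          rw [hw]
          ring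
      _ ≤ L * τ ^ 2 / 2 := by gcongr
  calc p ≤ (2 + 80 * unionBoundConst) * (B / w) * Real.exp (-(0.44 * w)) :=
        le_div_mul_exp_neg_of_tail_bound hconst hB hw0 hwB1 hr hp1 hp
    _ ≤ (2 + 80 * unionBoundConst) * (2 * (ε⁻¹ * H)) * Real.exp (-(w * B ^ 2 * (450 / H ^ 2))) := by
        have hprefactor := div_rate_le_inv_mul hL hα hε hB hH hBA hεAB
        have hrate := rate_mul_le_of_lip_le hw0.le hB hBH
        gcongr ?_ * ?_ * Real.exp (-?_)
    _ = exceptionalFrequency L α ε H := by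
        rw [exceptionalFrequency, reductionConst, hwB]
        ring

theorem sq_le_mul_sq_of_mul_rpow_le (hL : 0 < L) (hα : 0 ≤ α)
    (h : α * L ^ (-(1 / 2) : ℝ) ≤ ε) : α ^ 2 ≤ L * ε ^ 2 := by
  rw [Real.rpow_neg hL.le, ← Real.sqrt_eq_rpow, ← div_eq_mul_inv,
    div_le_iff₀ (Real.sqrt_pos.2 hL)] at h
  calc α ^ 2 ≤ (ε * √L) ^ 2 := by gcongr
    _ = L * ε ^ 2 := by rw [mul_pow, Real.sq_sqrt hL.le, mul_comm]

theorem exists_nat_rat_mul_add_le {a d K : ℝ} (hK0 : 0 ≤ K) (hK1 : K < 1) (hB : 0 < B)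
    (hd : 0 < d) (ha : B * a ≤ d / 4) :
    ∃ n : ℕ, 0 < n ∧ ∃ τ : ℚ, 1.1 * (d / B) ≤ τ ∧ B * (a + K ^ n + 0.56 * τ) ≤ d := by
  have hlim : Tendsto (fun n : ℕ => B * K ^ n) atTop (nhds 0) := by
    simpa using (tendsto_pow_atTop_nhds_zero_of_lt_one hK0 hK1).const_mul B
  obtain ⟨n, hn, hn0⟩ := ((hlim.eventually_lt_const (show 0 < 0.05 * d by positivity)).and
    (eventually_gt_atTop 0)).exists
  obtain ⟨τ, hτ, hτ'⟩ := exists_rat_btwn (show 1.1 * (d / B) < 1.2 * (d / B) by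
    gcongr
    norm_num)
  have hBτ : B * τ ≤ 1.2 * d :=
    calc B * τ ≤ B * (1.2 * (d / B)) := by gcongr
      _ = 1.2 * d := by field_simp
  exact ⟨n, hn0, τ, hτ.le, by linarith⟩

end TailBound

section Reduction

open scoped NNReal

variable {Ω : Type*} {L : ℕ} {θ : Ω → Ω} {φ : Fin (L + 1) → ℕ → Ω → UnitAddCircle → UnitAddCircle}
  {h : Ω → UnitAddCircle → UnitAddCircle → ℝ} {α ε : ℝ} {K : ℝ≥0} {m : Measure UnitAddCircle}

theorem fluctuation_eq_zero_of_forall_eq (hL : 0 < L) [IsProbabilityMeasure m] {ω : Ω}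
    {x : Fin (L + 1) → UnitAddCircle} {c : ℝ} (hc : ∀ y, h ω (x 0) y = c) (α : ℝ) :
    fluctuation h α m ω x = 0 := by
  have : (L : ℝ) ≠ 0 := by exact_mod_cast hL.ne'
  simp [fluctuation, hc, this]

theorem admitsReduction_zero_of_iSup_lipConst_eq_zero (hL : 0 < L) [IsProbabilityMeasure m]
    (hsmooth : ∀ ω, IsC4 (h ω)) {ω : Ω}
    (hbdd : BddAbove (Set.range fun t : ℕ => normC4 (h (θ^[t] ω))))
    (hB : ⨆ t : ℕ, lipConst (h (θ^[t] ω)) = 0) (hε : 0 ≤ ε) (x : Fin (L + 1) → UnitAddCircle) :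
    AdmitsReduction θ φ h α m ε 0 ω x := by
  refine admitsReduction_of_forall_mem (E := ∅) (n := 0) (fun t ht => absurd ?_ ht)
    (by simp [birkhoffAverage, birkhoffSum])
  have hlip : LipschitzWith 0 (Function.uncurry (h (θ^[t] ω))) :=
    (hsmooth _).lipschitzWith_of_lipConst_le
      ((le_ciSup (bddAbove_range_lipConst (fun t => hsmooth (θ^[t] ω)) hbdd) t).trans_eq hB)
  rw [AdmitsReductionAt, add_zero, fluctuation_eq_zero_of_forall_eq hL
    (fun y => (LipschitzWith.zero_iff _).1 hlip (_, y) (0, 0)), abs_zero]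
  exact hε

variable [MeasurableSpace Ω] {P : Measure Ω} [IsProbabilityMeasure P]

theorem admitsReduction_exceptionalFrequency_of_lipschitzWith (hθ : MeasurePreserving θ P P)
    (hL : 0 < L) (hα : 0 < α) (hrds : ∀ i, IsRDS θ (φ i)) (hK1 : K < 1)
    (hK : ∀ i ω, LipschitzWith K (φ i 1 ω)) (hnodes : IIDNodeMaps P θ φ)
    (hsmooth : ∀ ω, IsC4 (h ω)) (hm : ∀ i, IsStationaryMeasure P (φ i) m) {ω : Ω}
    (hfreq : ∀ n > 0, ∀ τ : ℚ, Tendsto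
      (fun T => birkhoffAverage ℝ θ ((deviationEvent P φ n τ).indicator 1) T ω) atTop
      (nhds (P.real (deviationEvent P φ n τ))))
    {A H : ℝ} (hA : ∀ t p q, |h (θ^[t] ω) p q| ≤ A) {B : ℝ≥0} (hB0 : 0 < B)
    (hB : ∀ t, LipschitzWith B (Function.uncurry (h (θ^[t] ω)))) (hBH : B ≤ H / 32)
    (hBA : (B : ℝ) ^ 2 ≤ 8 * A * H) (hε : 0 < ε) (hαε : α ^ 2 ≤ L * ε ^ 2)
    (hεAB : 4 * α ^ 2 * A * B ≤ ε * (L * (1 - K))) (x : Fin (L + 1) → UnitAddCircle) :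
    AdmitsReduction θ φ h α m ε (exceptionalFrequency L α ε H) ω x := by
  have hL0 : (0 : ℝ) < L := by exact_mod_cast hL
  have hgap : (0 : ℝ) < 1 - K := sub_pos.2 hK1
  have : 0 ≤ A := (abs_nonneg _).trans (hA 0 0 0)
  have hshadow : B * (α * A / (L * (1 - K))) ≤ ε / α / 4 := by
    rw [mul_div_assoc', div_div, div_le_div_iff₀ (by positivity) (by positivity)]
    linarith
  obtain ⟨n, hn, τ, hτ, hbudget⟩ :=
    exists_nat_rat_mul_add_le K.coe_nonneg hK1 (NNReal.coe_pos.2 hB0) (div_pos hε hα) hshadow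
  have hτ0 : (0 : ℝ) ≤ τ := hτ.trans' (by positivity)
  have hεAB' : 4 * α ^ 2 * A * B ≤ ε * L := by
    refine hεAB.trans ?_
    gcongr
    exact mul_le_of_le_one_right hL0.le (sub_le_self 1 K.coe_nonneg)
  have hbound : P.real (deviationEvent P φ n τ) ≤ exceptionalFrequency L α ε H :=
    le_exceptionalFrequency_of_tail_bound hL0 hα hε hB0 hBH hBA hαε hεAB' hτ measureReal_le_one
      (measureReal_deviationEvent_le hL hθ.measurable hrds (fun i ω => (hK i ω).continuous)
        hnodes n)
  refine (admitsReduction_of_forall_mem (n := n) (fun s hs => ?_) (hfreq n hn τ)).mono hbound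
  by_contra hnot
  exact hs ((abs_fluctuation_le_of_notMem_deviationEvent hL hα.le hθ hrds hK1 hK hnodes hm
    hsmooth hA hB hτ0 hnot x).trans ((le_div_iff₀' hα).1 hbudget))

theorem admitsReduction_exceptionalFrequency (hθ : MeasurePreserving θ P P) (hL : 0 < L)
    (hα : 0 < α) (hrds : ∀ i, IsRDS θ (φ i)) (hK1 : K < 1)
    (hK : ∀ i ω, LipschitzWith K (φ i 1 ω)) (hnodes : IIDNodeMaps P θ φ)
    (hsmooth : ∀ ω, IsC4 (h ω)) (hm : ∀ i, IsStationaryMeasure P (φ i) m) {ω : Ω}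
    (hfreq : ∀ n > 0, ∀ τ : ℚ, Tendsto
      (fun T => birkhoffAverage ℝ θ ((deviationEvent P φ n τ).indicator 1) T ω) atTop
      (nhds (P.real (deviationEvent P φ n τ))))
    (hbdd : BddAbove (Set.range fun t : ℕ => normC4 (h (θ^[t] ω))))
    (hε : max (α * (L : ℝ) ^ (-(1 / 2) : ℝ))
      (4 * α ^ 2 * (L : ℝ)⁻¹ * (1 - (K : ℝ))⁻¹ * (⨆ t : ℕ, normC0 (h (θ^[t] ω))) *
        (⨆ t : ℕ, lipConst (h (θ^[t] ω)))) ≤ ε) (x : Fin (L + 1) → UnitAddCircle) :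
    AdmitsReduction θ φ h α m ε
      (exceptionalFrequency L α ε (⨆ t : ℕ, normC4 (h (θ^[t] ω)))) ω x := by
  have hprob := (hm 0).isProb
  have hL0 : (0 : ℝ) < L := by exact_mod_cast hL
  have hgap : (0 : ℝ) < 1 - K := sub_pos.2 hK1
  have hG (t : ℕ) : IsC4 (h (θ^[t] ω)) := hsmooth _
  obtain ⟨hε1, hε2⟩ := max_le_iff.1 hε
  have hε0 : 0 < ε := lt_of_lt_of_le (by positivity) hε1
  have hA (t : ℕ) (p q) : |h (θ^[t] ω) p q| ≤ ⨆ t : ℕ, normC0 (h (θ^[t] ω)) :=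
    ((hG t).abs_le_normC0 p q).trans (le_ciSup (bddAbove_range_normC0 hG hbdd) t)
  have hB (t : ℕ) := le_ciSup (bddAbove_range_lipConst hG hbdd) t
  have hBH := iSup_lipConst_le_iSup_normC4 hG hbdd
  have hBA := sq_iSup_lipConst_le hG hbdd
  have hB0 : 0 ≤ ⨆ t : ℕ, lipConst (h (θ^[t] ω)) := Real.iSup_nonneg fun t => lipConst_nonneg _
  generalize hBdef : ⨆ t : ℕ, lipConst (h (θ^[t] ω)) = B at *
  lift B to ℝ≥0 using hB0
  rcases eq_or_ne B 0 with rfl | hB0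
  · exact (admitsReduction_zero_of_iSup_lipConst_eq_zero hL hsmooth hbdd hBdef hε0.le x).mono
      (exceptionalFrequency_nonneg _ _ hε0.le (Real.iSup_nonneg fun t => (hG t).normC4_nonneg))
  · refine admitsReduction_exceptionalFrequency_of_lipschitzWith hθ hL hα hrds hK1 hK hnodes
      hsmooth hm hfreq hA (pos_iff_ne_zero.2 hB0)
      (fun t => (hG t).lipschitzWith_of_lipConst_le (hB t)) hBH hBA hε0
      (sq_le_mul_sq_of_mul_rpow_le hL0 hα.le hε1) ?_ x
    rw [← div_le_iff₀ (by positivity)]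
    refine le_of_eq_of_le ?_ hε2
    field_simp

theorem ae_admitsReduction_exceptionalFrequency (hθ : MeasurePreserving θ P P) (hL : 0 < L)
    (hα : 0 < α) (hrds : ∀ i, IsRDS θ (φ i)) (hK1 : K < 1)
    (hK : ∀ i ω, LipschitzWith K (φ i 1 ω)) (hnodes : IIDNodeMaps P θ φ)
    (hsmooth : ∀ ω, IsC4 (h ω)) (hm : ∀ i, IsStationaryMeasure P (φ i) m) :
    ∀ᵐ ω ∂P, BddAbove (Set.range fun t : ℕ => normC4 (h (θ^[t] ω))) →
      ∀ ε : ℝ,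
        max (α * (L : ℝ) ^ (-(1 / 2) : ℝ))
          (4 * α ^ 2 * (L : ℝ)⁻¹ * (1 - (K : ℝ))⁻¹ * (⨆ t : ℕ, normC0 (h (θ^[t] ω))) *
            (⨆ t : ℕ, lipConst (h (θ^[t] ω)))) ≤ ε →
        ∀ x : Fin (L + 1) → UnitAddCircle,
          AdmitsReduction θ φ h α m ε
            (exceptionalFrequency L α ε (⨆ t : ℕ, normC4 (h (θ^[t] ω)))) ω x := by
  have hfreq : ∀ᵐ ω ∂P, ∀ n > 0, ∀ τ : ℚ, Tendsto
      (fun T => birkhoffAverage ℝ θ ((deviationEvent P φ n τ).indicator 1) T ω) atTop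
      (nhds (P.real (deviationEvent P φ n τ))) := by
    simp only [ae_all_iff]
    exact fun n hn τ => ae_tendsto_birkhoffAverage_deviationEvent hθ hrds
      (fun i ω => (hK i ω).continuous) hnodes hn τ
  filter_upwards [hfreq] with ω hω hbdd ε hε x
  exact admitsReduction_exceptionalFrequency hθ hL hα hrds hK1 hK hnodes hsmooth hm hω hbdd hε x

end Reduction

open scoped NNReal in
theorem mainTheorem8_general :
    ∃ C : ℝ, 0 < C ∧
      ∀ (Ω : Type*) [MeasurableSpace Ω] (P : Measure Ω) [IsProbabilityMeasure P]
        (θ : Ω → Ω) (_hθ : MeasurePreserving θ P P)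
        (L : ℕ) (_hL : 1 ≤ L)
        (φ : Fin (L + 1) → ℕ → Ω → UnitAddCircle → UnitAddCircle)
        (h : Ω → UnitAddCircle → UnitAddCircle → ℝ)
        (α : ℝ) (K : ℝ≥0) (_hα : 0 < α) (_hK1 : K < 1)
        (_hrds : ∀ i, IsRDS θ (φ i))
        (_hK : ∀ i ω, LipschitzWith K (φ i 1 ω))
        (_hnodes : IIDNodeMaps P θ φ)
        (_hsmooth : ∀ ω, IsC4 (h ω)),
        (∀ i, IsStationaryMeasure P (φ i) (codingMeasure P θ (φ 0)) ∧
          ∀ m, IsStationaryMeasure P (φ i) m → m = codingMeasure P θ (φ 0)) ∧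
        ∀ᵐ ω ∂P, BddAbove (Set.range fun t : ℕ => normC4 (h (θ^[t] ω))) →
          ∀ ε : ℝ,
            max (α * (L : ℝ) ^ (-(1 / 2) : ℝ))
              (4 * α ^ 2 * (L : ℝ)⁻¹ * (1 - (K : ℝ))⁻¹ *
                (⨆ t : ℕ, normC0 (h (θ^[t] ω))) * (⨆ t : ℕ, lipConst (h (θ^[t] ω)))) ≤ ε →
            ∀ x : Fin (L + 1) → UnitAddCircle,
              AdmitsReduction θ φ h α (codingMeasure P θ (φ 0)) ε
                ((C * ε⁻¹ * ⨆ t : ℕ, normC4 (h (θ^[t] ω))) *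
                  Real.exp (-(L * ε ^ 2 * α⁻¹ ^ 2 *
                    (450 / (⨆ t : ℕ, normC4 (h (θ^[t] ω))) ^ 2))))
                ω x := by
  refine ⟨reductionConst, reductionConst_pos, ?_⟩
  intro Ω _ P _ θ hθ L hL φ h α K hα hK1 hrds hK hnodes hsmooth
  have hm (i) := isStationaryMeasure_codingMeasure hθ hrds hK1 hK hnodes i 0
  exact ⟨fun i => ⟨hm i, fun m hm' => hm'.eq ((hrds i).measurable 1) hK1 (hK i) (hm i)⟩,
    ae_admitsReduction_exceptionalFrequency hθ hL hα hrds hK1 hK hnodes hsmooth hm⟩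

theorem mainTheorem8 :
    ∃ C : ℝ, 0 < C ∧
      ∀ (Ω : Type*) [MeasurableSpace Ω] (P : Measure Ω) [IsProbabilityMeasure P]
        (θ : Ω → Ω) (_hθ : MeasurePreserving θ P P)
        (L : ℕ) (_hL : 1 ≤ L)
        (φ : Fin (L + 1) → ℕ → Ω → UnitAddCircle → UnitAddCircle)
        (h : Ω → UnitAddCircle → UnitAddCircle → ℝ)
        (α lam : ℝ) (_hα : 0 < α) (_hlam : lam ∈ Set.Ioo (0 : ℝ) 1)
        (_hrds : ∀ i, IsRDS θ (φ i))
        (_hcontr : ∀ i ω x y, dist (φ i 1 ω x) (φ i 1 ω y) ≤ lam * dist x y)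
        (_hnodes : IIDNodeMaps P θ φ)
        (_hcoupling : IIDCoupling P θ h),
        (∀ i, IsStationaryMeasure P (φ i) (codingMeasure P θ (φ 0)) ∧
          ∀ m, IsStationaryMeasure P (φ i) m → m = codingMeasure P θ (φ 0)) ∧
        ∀ᵐ ω ∂P, BddAbove (Set.range fun t : ℕ => normC4 (h (θ^[t] ω))) →
          ∀ ε : ℝ,
            max (α * (L : ℝ) ^ (-(1 / 2) : ℝ))
              (4 * α ^ 2 * (L : ℝ)⁻¹ * (1 - lam)⁻¹ *
                (⨆ t : ℕ, normC0 (h (θ^[t] ω))) * (⨆ t : ℕ, lipConst (h (θ^[t] ω)))) ≤ ε →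
            ∀ x : Fin (L + 1) → UnitAddCircle,
              AdmitsReduction θ φ h α (codingMeasure P θ (φ 0)) ε
                ((C * ε⁻¹ * ⨆ t : ℕ, normC4 (h (θ^[t] ω))) *
                  Real.exp (-(L * ε ^ 2 * α⁻¹ ^ 2 *
                    (450 / (⨆ t : ℕ, normC4 (h (θ^[t] ω))) ^ 2))))
                ω x := by
  obtain ⟨C, hC, hmain⟩ := mainTheorem8_general
  exact ⟨C, hC, fun Ω _ P _ θ hθ L hL φ h α lam hα hlam hrds hcontr hnodes hcoupling =>
    hmain Ω P θ hθ L hL φ h α ⟨lam, hlam.1.le⟩ hα hlam.2 hrds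
      (fun i ω => LipschitzWith.of_dist_le_mul (hcontr i ω)) hnodes hcoupling.smooth⟩
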